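/- Let $S$ be a finite set of points in the Euclidean plane in general position (no three of them collinear), and let $K_S$ be the complete geometric graph on $S$, whose edges are the straight-line segments joining the points of $S$. Two distinct edges cross if they have a common point that is interior to both of them; a geometric graph is non-crossing (plane) if no two of its edges cross. For a natural number $k$, say that $S$ admits a plane triangle-free $k$-packing if there are $k$ pairwise edge-disjoint non-crossing perfect matchings $F_1,\dots,F_k$ of $K_S$ such that the geometric graph $F_1\cup\dots\cup F_k$ on $S$ is plane and triangle-free. Then for every integer $n\ge 4$: 1. Every set $S$ of $2n$ points in general position in the plane admits a plane triangle-free $2$-packing, and if $S$ admits a plane triangle-free $k$-packing then $k\le 3$. That is, the maximum $k$ is at least $2$ and at most $3$. 2. Both bounds are tight: there is a set of $2n$ points in general position in the plane for which the maximum $k$ is exactly $2$; and there is a set of $2n$ points in general position in the plane for which the maximum $k$ is exactly $3$, attained by a plane triangle-free $3$-packing whose union $F_1\cup F_2\cup F_3$ is isomorphic to the prism $C_n\,\square\,P_2$ (the Cartesian product of an $n$-cycle with a path on two vertices). -/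

import Mathlib

/-- The Euclidean plane. -/
abbrev Plane : Type := EuclideanSpace ℝ (Fin 2)

/-- A finite set of points of the plane is in general position if no three of its points
lie on a common line. -/
def InGeneralPosition (S : Finset Plane) : Prop :=
  ∀ a ∈ S, ∀ b ∈ S, ∀ c ∈ S, a ≠ b → a ≠ c → b ≠ c → ¬ Collinear ℝ ({a, b, c} : Set Plane)

/-- The complete geometric graph on `S`: every two distinct points of `S` are adjacent. -/
abbrev completeGeometricGraph (S : Finset Plane) : SimpleGraph S := ⊤

/-- A graph whose vertices are the points of `S` is regarded as a geometric graph, the edge `ab`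
being the straight-line segment from `a` to `b`. It is non-crossing (plane) if no two distinct
edges have a common point that is interior to both of them. -/
def IsNonCrossing {S : Finset Plane} (G : SimpleGraph S) : Prop :=
  ∀ a b c d : S, G.Adj a b → G.Adj c d → s(a, b) ≠ s(c, d) →
    Disjoint (openSegment ℝ (a : Plane) (b : Plane)) (openSegment ℝ (c : Plane) (d : Plane))

/-- The union of a family of subgraphs of the complete geometric graph on `S`, as a graph whose
vertex set is `S`. -/
def unionGraph {S : Finset Plane} {k : ℕ}
    (F : Fin k → (completeGeometricGraph S).Subgraph) : SimpleGraph S :=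
  (⨆ i, F i).spanningCoe

/-- `F` is a family of `k` pairwise edge-disjoint non-crossing perfect matchings of the complete
geometric graph on `S` whose union is a triangle-free plane geometric graph. -/
structure IsPlaneTriangleFreePacking (S : Finset Plane) (k : ℕ)
    (F : Fin k → (completeGeometricGraph S).Subgraph) : Prop where
  perfect : ∀ i, (F i).IsPerfectMatching
  nonCrossing : ∀ i, IsNonCrossing (F i).spanningCoe
  edgeDisjoint : ∀ i j, i ≠ j → Disjoint (F i).edgeSet (F j).edgeSet
  triangleFree : (unionGraph F).CliqueFree 3
  plane : IsNonCrossing (unionGraph F)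

/-- The set of all `k` such that `k` edge-disjoint non-crossing perfect matchings can be packed
into the complete geometric graph on `S` with a triangle-free plane union. -/
def packingSizes (S : Finset Plane) : Set ℕ :=
  {k | ∃ F : Fin k → (completeGeometricGraph S).Subgraph, IsPlaneTriangleFreePacking S k F}

/-- The prism with `2 * n` vertices: the Cartesian product of an `n`-cycle with a path on two
vertices. -/
def prismGraph (n : ℕ) : SimpleGraph (Fin n × Fin 2) :=
  (SimpleGraph.cycleGraph n).boxProd (SimpleGraph.pathGraph 2)

/-! Upper bound 3. In a packing of `k` matchings every vertex has `k` distinct neighbours, so `k ≥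
4` gives a plane triangle-free graph with `E ≥ 2V`. This contradicts
`IsPlaneDrawing.card_edgeFinset_lt`, which plays the role of Euler's formula and is proved over
`ZMod 2`. For an even edge set `w`, counting the edges of `w` below a point modulo 2 two-colours the
regions of the drawing. A region is represented by a class of darts under the face-tracing map `f`.
The colour is constant on such a class, and colours on the two sides of an edge differ by the weight
of the edge, so `w` together with a global shift `s` is recovered from the colouring. The even sets
number at least `2 ^ (E - V)`, hence `E - V + 1` is at most the number of classes. Minimum degree
two and triangle-freeness put at least four of the `2E` darts in each class, so there are at most `E
/ 2` classes and `E ≤ 2V - 2`.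

Lower bound 2. A farthest point from the origin sees all the others within an open half-plane.
Visiting them in angular order gives a simple polygon with `2n` sides, whose alternate sides form
two matchings (`exists_polygonization`, `two_mem_packingSizes`).

Tightness. For points on a parabola, a vertex just inside a shortest chord has at most two
neighbours in any plane graph, so three matchings do not fit. The prism is 3-edge-colourable, and
drawing its cycles on two opposite parabolas with vertical rungs makes it plane
(`disjoint_openSegment_prismPoint`), so its colour classes attain 3. -/

/-! ### Packings, fixed-point-free involutions and degrees -/

/-- Reduces each construction to combinatorics on an index type: a perfect matching is a
fixed-point-free involution, and edge-disjointness says that no vertex has the same partner twice.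
Each matching is non-crossing because the union is. -/
theorem exists_packing_of_involutions {V : Type*} {k : ℕ} {S : Finset Plane} (e : V ≃ S)
    (m : Fin k → V → V) (hinv : ∀ i v, m i (m i v) = v) (hne : ∀ i v, m i v ≠ v)
    (hdis : ∀ i j v, m i v = m j v → i = j) (G : SimpleGraph V)
    (hG : ∀ u v, G.Adj u v ↔ ∃ i, m i u = v) (hfree : G.CliqueFree 3)
    (hplane : ∀ a b c d, G.Adj a b → G.Adj c d → s(a, b) ≠ s(c, d) →
      Disjoint (openSegment ℝ (e a : Plane) (e b)) (openSegment ℝ (e c : Plane) (e d))) :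
    ∃ F : Fin k → (completeGeometricGraph S).Subgraph,
      IsPlaneTriangleFreePacking S k F ∧ Nonempty (unionGraph F ≃g G) := by
  let F : Fin k → (completeGeometricGraph S).Subgraph := fun i =>
    { verts := Set.univ
      Adj := fun a b => m i (e.symm a) = e.symm b
      adj_sub := by
        intro a b h
        have : a ≠ b := by
          rintro rfl
          exact hne _ _ h
        simpa using this
      edge_vert := by simp
      symm := ⟨by
        intro a b h
        rw [← h, hinv]⟩ }
  have hU : ∀ a b, (unionGraph F).Adj a b ↔ G.Adj (e.symm a) (e.symm b) := by
    intro a b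
    rw [hG]
    simp [unionGraph, F]
  have hiso : Nonempty (unionGraph F ≃g G) := ⟨⟨e.symm, fun {a b} => (hU a b).symm⟩⟩
  have hP : IsNonCrossing (unionGraph F) := by
    intro a b c d hab hcd hne'
    have := hplane (e.symm a) (e.symm b) (e.symm c) (e.symm d) ((hU _ _).1 hab) ((hU _ _).1 hcd)
      (by
        intro h
        apply hne'
        have := congrArg (Sym2.map e) h
        simpa using this)
    simpa using this
  refine ⟨F, ⟨?_, ?_, ?_, ?_, hP⟩, hiso⟩
  · intro i
    refine ⟨?_, fun v => Set.mem_univ v⟩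
    intro v _
    refine ⟨e (m i (e.symm v)), by simp [F], ?_⟩
    intro w hw
    have : m i (e.symm v) = e.symm w := hw
    simp [this]
  · intro i a b c d hab hcd
    refine hP a b c d ?_ ?_
    · exact (hU _ _).2 ((hG _ _).2 ⟨i, hab⟩)
    · exact (hU _ _).2 ((hG _ _).2 ⟨i, hcd⟩)
  · intro i j hij
    rw [Set.disjoint_left]
    intro x
    induction x with
    | h a b =>
      intro h1 h2
      have h1' : m i (e.symm a) = e.symm b := h1
      have h2' : m j (e.symm a) = e.symm b := h2
      exact hij (hdis _ _ _ (h1'.trans h2'.symm))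
  · obtain ⟨f⟩ := hiso
    exact hfree.comap f.toEmbedding.toCopy.isContained

/-- Disjoint matchings give a vertex different partners, so all degrees of the union are at least
`k`. Both upper bounds start from this. -/
theorem exists_injective_adj_unionGraph {S : Finset Plane} {k : ℕ}
    {F : Fin k → (completeGeometricGraph S).Subgraph} (hF : IsPlaneTriangleFreePacking S k F)
    (v : S) : ∃ f : Fin k → S, Function.Injective f ∧ ∀ i, (unionGraph F).Adj v (f i) := by
  have h : ∀ i, ∃ w, (F i).Adj v w := fun i =>
    ((hF.perfect i).1 ((hF.perfect i).2 v)).exists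
  choose f hf using h
  refine ⟨f, ?_, ?_⟩
  · intro i j hij
    by_contra hne
    have h1 : s(v, f i) ∈ (F i).edgeSet := hf i
    have h2 : s(v, f i) ∈ (F j).edgeSet := by
      rw [hij]
      exact hf j
    exact Set.disjoint_left.1 (hF.edgeDisjoint i j hne) h1 h2
  · intro i
    simp only [unionGraph, SimpleGraph.Subgraph.spanningCoe_adj, SimpleGraph.Subgraph.iSup_adj]
    exact ⟨i, hf i⟩

/-! ### Coordinates and orientation -/

theorem mem_openSegment_coord {p q r : Plane} (h : r ∈ openSegment ℝ p q) :
    ∃ s t : ℝ, 0 < s ∧ 0 < t ∧ s + t = 1 ∧ r 0 = s * p 0 + t * q 0 ∧ r 1 = s * p 1 + t * q 1 := by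
  obtain ⟨s, t, hs, ht, hst, rfl⟩ := h
  exact ⟨s, t, hs, ht, hst, by simp, by simp⟩

/-- The signed area of the parallelogram spanned by `q - p` and `r - p`. -/
def orient (p q r : Plane) : ℝ :=
  (q 0 - p 0) * (r 1 - p 1) - (q 1 - p 1) * (r 0 - p 0)

theorem collinear_of_orient_eq_zero {p q r : Plane} (h : orient p q r = 0) :
    Collinear ℝ ({p, q, r} : Set Plane) := by
  by_cases hpq : p = q
  · subst hpq
    simpa using collinear_pair ℝ p r
  rw [collinear_iff_of_mem (p₀ := p) (by simp)]
  refine ⟨q - p, ?_⟩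
  have hd : 0 < (q 0 - p 0) ^ 2 + (q 1 - p 1) ^ 2 := by
    by_contra hcon
    apply hpq
    ext i
    fin_cases i
    · show p 0 = q 0
      nlinarith [sq_nonneg (q 0 - p 0), sq_nonneg (q 1 - p 1)]
    · show p 1 = q 1
      nlinarith [sq_nonneg (q 0 - p 0), sq_nonneg (q 1 - p 1)]
  intro s hs
  simp only [Set.mem_insert_iff, Set.mem_singleton_iff] at hs
  rcases hs with rfl | rfl | rfl
  · exact ⟨0, by simp⟩
  · exact ⟨1, by simp⟩
  · refine ⟨((q 0 - p 0) * (s 0 - p 0) + (q 1 - p 1) * (s 1 - p 1)) /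
      ((q 0 - p 0) ^ 2 + (q 1 - p 1) ^ 2), ?_⟩
    unfold orient at h
    ext i
    fin_cases i
    · simp
      field_simp
      linear_combination (-(q 1 - p 1)) * h
    · simp
      field_simp
      linear_combination (q 0 - p 0) * h

theorem orient_eq_zero_of_collinear {p q r : Plane} (h : Collinear ℝ ({p, q, r} : Set Plane)) :
    orient p q r = 0 := by
  rw [collinear_iff_of_mem (p₀ := p) (by simp)] at h
  obtain ⟨v, hv⟩ := h
  obtain ⟨s, hs⟩ := hv q (by simp)
  obtain ⟨t, ht⟩ := hv r (by simp)
  subst hs ht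
  simp [orient]
  ring

/-! ### Straight-line plane graphs and the count of their edges -/

namespace StraightLine

variable {V : Type*}

/-- The slope of the line through the positions of `a` and `b`. -/
noncomputable def slopeOf (x y : V → ℝ) (a b : V) : ℝ := (y b - y a) / (x b - x a)

/-- The height at abscissa `t` of the line through the positions of `a` and `b`. -/
noncomputable def lineAt (x y : V → ℝ) (a b : V) (t : ℝ) : ℝ :=
  y a + slopeOf x y a b * (t - x a)

/-- A straight-line drawing without crossings and without vertices inside edges, whose vertices
have distinct abscissas. -/
structure IsPlaneDrawing (G : SimpleGraph V) (x y : V → ℝ) : Prop where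
  inj : Function.Injective x
  vertex : ∀ a b c, G.Adj a b → x a < x c → x c < x b → y c ≠ lineAt x y a b (x c)
  edge : ∀ a b c d t, G.Adj a b → G.Adj c d → x a < t → t < x b → x c < t → t < x d →
    lineAt x y a b t = lineAt x y c d t → a = c ∧ b = d

variable {x y : V → ℝ}

theorem slopeOf_comm (a b : V) : slopeOf x y a b = slopeOf x y b a := by
  unfold slopeOf
  rw [← neg_sub (y a), ← neg_sub (x a), neg_div_neg_eq]

theorem lineAt_left (a b : V) : lineAt x y a b (x a) = y a := by simp [lineAt]

theorem lineAt_right {a b : V} (h : x a < x b) : lineAt x y a b (x b) = y b := by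
  have : x b - x a ≠ 0 := by linarith
  simp only [lineAt, slopeOf]
  field_simp
  ring

theorem lineAt_eq_right {a b : V} (h : x a < x b) (t : ℝ) :
    lineAt x y a b t = y b + slopeOf x y a b * (t - x b) := by
  have := lineAt_right (y := y) h
  unfold lineAt at *
  linarith

theorem exists_root {α β s τ : ℝ} (hs : α + β * s < 0) (ht : 0 < α + β * τ) :
    ∃ r, α + β * r = 0 ∧ ((s < r ∧ r < τ) ∨ (τ < r ∧ r < s)) := by
  have hβ : β ≠ 0 := by
    rintro rfl
    linarith
  refine ⟨-α / β, by field_simp; ring, ?_⟩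
  rcases lt_or_gt_of_ne hβ with h | h
  · right
    rw [lt_div_iff_of_neg h, div_lt_iff_of_neg h]
    constructor <;> linarith
  · left
    rw [lt_div_iff₀ h, div_lt_iff₀ h]
    constructor <;> linarith

theorem lineAt_sub (a b v u : V) : ∃ α β : ℝ, ∀ t,
    lineAt x y a b t - lineAt x y v u t = α + β * t :=
  ⟨y a - slopeOf x y a b * x a - (y v - slopeOf x y v u * x v),
    slopeOf x y a b - slopeOf x y v u, fun t => by unfold lineAt; ring⟩

/-- Two edges over a common interval keep their vertical order. -/
theorem IsPlaneDrawing.lt_of_lt {G : SimpleGraph V} (h : IsPlaneDrawing G x y) {a b v u : V}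
    (hab : G.Adj a b) (hvu : G.Adj v u) (hne : ¬ (a = v ∧ b = u)) {s τ : ℝ}
    (h1 : x a ≤ s) (h2 : x v ≤ s) (h3 : s ≤ x b) (h4 : s ≤ x u)
    (h5 : x a < τ) (h6 : x v < τ) (h7 : τ < x b) (h8 : τ < x u)
    (hs : lineAt x y a b s < lineAt x y v u s) : lineAt x y a b τ < lineAt x y v u τ := by
  by_contra hcon
  push Not at hcon
  rcases hcon.lt_or_eq with hlt | heq
  -- The difference of the two heights is affine, so a change of sign yields a common point strictly
  -- between `s` and `τ`, interior to both edges.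
  · obtain ⟨α, β, hD⟩ := lineAt_sub (x := x) (y := y) a b v u
    obtain ⟨r, hr, hr'⟩ := exists_root (α := α) (β := β) (s := s) (τ := τ)
      (by rw [← hD]; linarith) (by rw [← hD]; linarith)
    have : lineAt x y a b r = lineAt x y v u r := by
      have := hD r
      linarith
    refine hne (h.edge a b v u r hab hvu ?_ ?_ ?_ ?_ this) <;>
      rcases hr' with ⟨_, _⟩ | ⟨_, _⟩ <;> linarith
  · exact hne (h.edge a b v u τ hab hvu h5 h7 h6 h8 heq.symm)

variable (x y)

/-- The edge `ab`, directed to the right, passes below the vertex `v` or leaves `v` to the right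
below or along the edge `vu`. -/
def BelowLeft (v u a b : V) : Prop :=
  (x a < x v ∧ x v < x b ∧ lineAt x y a b (x v) < y v) ∨
    (a = v ∧ x v < x b ∧ slopeOf x y v b ≤ slopeOf x y v u)

/-- The edge `ab`, directed to the right, passes below the vertex `u` or enters `u` from the left
below or along the edge `vu`. -/
def BelowRight (v u a b : V) : Prop :=
  (x a < x u ∧ x u < x b ∧ lineAt x y a b (x u) < y u) ∨
    (b = u ∧ x a < x u ∧ slopeOf x y v u ≤ slopeOf x y a u)

/-- The vertex `a` lies strictly below the edge `vu`. -/
def BelowEdge (v u a : V) : Prop :=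
  x v < x a ∧ x a < x u ∧ y a < lineAt x y v u (x a)

variable {x y}

/-- Applying `lt_of_lt` to the two edges in either order makes the comparison an equivalence.
Equality has to be excluded only at `s`, which may be an end of an edge. -/
theorem IsPlaneDrawing.lt_of_not_lt {G : SimpleGraph V} (h : IsPlaneDrawing G x y) {a b v u : V}
    (hab : G.Adj a b) (hvu : G.Adj v u) (hne : ¬ (a = v ∧ b = u)) {s τ : ℝ}
    (h1 : x a ≤ s) (h2 : x v ≤ s) (h3 : s ≤ x b) (h4 : s ≤ x u)
    (h5 : x a < τ) (h6 : x v < τ) (h7 : τ < x b) (h8 : τ < x u)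
    (hs : lineAt x y a b s ≠ lineAt x y v u s) :
    lineAt x y a b s < lineAt x y v u s ↔ lineAt x y a b τ < lineAt x y v u τ := by
  refine ⟨h.lt_of_lt hab hvu hne h1 h2 h3 h4 h5 h6 h7 h8, fun ht => ?_⟩
  by_contra hcon
  have hlt : lineAt x y v u s < lineAt x y a b s := lt_of_le_of_ne (not_lt.1 hcon) hs.symm
  have := h.lt_of_lt hvu hab (fun e => hne ⟨e.1.symm, e.2.symm⟩) h2 h1 h4 h3 h6 h5 h8 h7 hlt
  linarith

open Classical in
-- The vertical order is constant over the common abscissas, so it can be read at the left end of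
-- the overlap. That end is `v`, where `BelowLeft` decides, or `a`, where `BelowEdge` decides; the
-- other indicator vanishes.
theorem IsPlaneDrawing.belowLeft_add_belowEdge {G : SimpleGraph V} (h : IsPlaneDrawing G x y)
    {a b v u : V} (hab : G.Adj a b) (hvu : G.Adj v u) (hx : x a < x b) (hx' : x v < x u)
    (hne : ¬ (a = v ∧ b = u)) {τ : ℝ}
    (h5 : x a < τ) (h6 : x v < τ) (h7 : τ < x b) (h8 : τ < x u) :
    (if BelowLeft x y v u a b then (1 : ZMod 2) else 0) + (if BelowEdge x y v u a then 1 else 0) =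
      if lineAt x y a b τ < lineAt x y v u τ then 1 else 0 := by
  rcases lt_trichotomy (x a) (x v) with hav | hav | hav
  · have e1 : ¬ BelowEdge x y v u a := fun hh => by linarith [hh.1]
    have e2 : BelowLeft x y v u a b ↔ lineAt x y a b τ < lineAt x y v u τ := by
      rw [← h.lt_of_not_lt hab hvu hne (s := x v) hav.le le_rfl (by linarith) (by linarith)
        h5 h6 h7 h8 (by
          rw [lineAt_left]
          exact (h.vertex a b v hab hav (by linarith)).symm), lineAt_left]
      constructor
      · rintro (⟨_, _, hh⟩ | ⟨rfl, _⟩)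
        · exact hh
        · exact absurd hav (lt_irrefl _)
      · intro hh
        exact Or.inl ⟨hav, by linarith, hh⟩
    simp [e1, e2]
  · obtain rfl := h.inj hav
    have e1 : ¬ BelowEdge x y a u a := fun hh => by linarith [hh.1]
    have e2 : BelowLeft x y a u a b ↔ lineAt x y a b τ < lineAt x y a u τ := by
      have hτ : 0 < τ - x a := by linarith
      have : lineAt x y a b τ < lineAt x y a u τ ↔ slopeOf x y a b < slopeOf x y a u := by
        unfold lineAt
        rw [add_lt_add_iff_left, mul_lt_mul_iff_left₀ hτ]
      rw [this]
      constructor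
      · rintro (⟨hh, _⟩ | ⟨_, _, hh⟩)
        · exact absurd hh (lt_irrefl _)
        · refine lt_of_le_of_ne hh fun e => hne (h.edge a b a u τ hab hvu h5 h7 h6 h8 ?_)
          unfold lineAt
          rw [e]
      · intro hh
        exact Or.inr ⟨rfl, hx, hh.le⟩
    simp [e1, e2]
  · have e1 : ¬ BelowLeft x y v u a b := by
      rintro (⟨hh, _⟩ | ⟨rfl, _⟩)
      · linarith
      · exact absurd hav (lt_irrefl _)
    have e2 : BelowEdge x y v u a ↔ lineAt x y a b τ < lineAt x y v u τ := by
      rw [← h.lt_of_not_lt hab hvu hne (s := x a) le_rfl hav.le hx.le (by linarith)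
        h5 h6 h7 h8 (by
          rw [lineAt_left]
          exact (h.vertex v u a hvu hav (by linarith))), lineAt_left]
      exact ⟨fun hh => hh.2.2, fun hh => ⟨hav, by linarith, hh⟩⟩
    simp [e1, e2]

open Classical in
-- The mirror image, read at the right end of the overlap. Slopes compare in the opposite sense for
-- edges that share their right end.
theorem IsPlaneDrawing.belowRight_add_belowEdge {G : SimpleGraph V} (h : IsPlaneDrawing G x y)
    {a b v u : V} (hab : G.Adj a b) (hvu : G.Adj v u) (hx : x a < x b) (hx' : x v < x u)
    (hne : ¬ (a = v ∧ b = u)) {τ : ℝ}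
    (h5 : x a < τ) (h6 : x v < τ) (h7 : τ < x b) (h8 : τ < x u) :
    (if BelowRight x y v u a b then (1 : ZMod 2) else 0) +
      (if BelowEdge x y v u b then 1 else 0) =
      if lineAt x y a b τ < lineAt x y v u τ then 1 else 0 := by
  rcases lt_trichotomy (x b) (x u) with hbu | hbu | hbu
  · have e1 : ¬ BelowRight x y v u a b := by
      rintro (⟨_, hh, _⟩ | ⟨rfl, _⟩)
      · linarith
      · exact absurd hbu (lt_irrefl _)
    have e2 : BelowEdge x y v u b ↔ lineAt x y a b τ < lineAt x y v u τ := by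
      rw [← h.lt_of_not_lt hab hvu hne (s := x b) hx.le (by linarith) le_rfl hbu.le
        h5 h6 h7 h8 (by
          rw [lineAt_right hx]
          exact (h.vertex v u b hvu (by linarith) hbu)), lineAt_right hx]
      exact ⟨fun hh => hh.2.2, fun hh => ⟨by linarith, hbu, hh⟩⟩
    simp [e1, e2]
  · obtain rfl := h.inj hbu
    have e1 : ¬ BelowEdge x y v b b := fun hh => by linarith [hh.2.1]
    have e2 : BelowRight x y v b a b ↔ lineAt x y a b τ < lineAt x y v b τ := by
      have hτ : τ - x b < 0 := by linarith
      have : lineAt x y a b τ < lineAt x y v b τ ↔ slopeOf x y v b < slopeOf x y a b := by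
        rw [lineAt_eq_right hx, lineAt_eq_right hx']
        rw [add_lt_add_iff_left, mul_lt_mul_right_of_neg hτ]
      rw [this]
      constructor
      · rintro (⟨_, hh, _⟩ | ⟨_, _, hh⟩)
        · exact absurd hh (lt_irrefl _)
        · refine lt_of_le_of_ne hh fun e => hne (h.edge a b v b τ hab hvu h5 h7 h6 h8 ?_)
          rw [lineAt_eq_right hx, lineAt_eq_right hx', e]
      · intro hh
        exact Or.inr ⟨rfl, hx, hh.le⟩
    simp [e1, e2]
  · have e1 : ¬ BelowEdge x y v u b := fun hh => by linarith [hh.2.1]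
    have e2 : BelowRight x y v u a b ↔ lineAt x y a b τ < lineAt x y v u τ := by
      rw [← h.lt_of_not_lt hab hvu hne (s := x u) (by linarith) hx'.le hbu.le le_rfl
        h5 h6 h7 h8 (by
          rw [lineAt_right hx']
          exact (h.vertex a b u hab (by linarith) hbu).symm), lineAt_right hx']
      constructor
      · rintro (⟨_, _, hh⟩ | ⟨rfl, _⟩)
        · exact hh
        · exact absurd hbu (lt_irrefl _)
      · intro hh
        exact Or.inl ⟨by linarith, hbu, hh⟩
    simp [e1, e2]

open Classical in
/-- The edges below an edge `vu` at its two ends differ by the edges that end below `vu`. -/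
theorem IsPlaneDrawing.belowLeft_add_belowRight {G : SimpleGraph V} (h : IsPlaneDrawing G x y)
    {a b v u : V} (hab : G.Adj a b) (hvu : G.Adj v u) (hx : x a < x b) (hx' : x v < x u) :
    (if BelowLeft x y v u a b then (1 : ZMod 2) else 0) +
      (if BelowRight x y v u a b then 1 else 0) =
      (if BelowEdge x y v u a then 1 else 0) + if BelowEdge x y v u b then 1 else 0 := by
  -- Modulo 2 the claim says that the left pair and the right pair have equal sums; over an overlap
  -- both sums equal the indicator at a common abscissa `τ`.
  have h2 : ∀ p q r s : ZMod 2, p + q = r + s → p + r = q + s := by decide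
  apply h2
  by_cases hne : a = v ∧ b = u
  · obtain ⟨rfl, rfl⟩ := hne
    have e1 : BelowLeft x y a b a b := Or.inr ⟨rfl, hx, le_rfl⟩
    have e2 : BelowRight x y a b a b := Or.inr ⟨rfl, hx, le_rfl⟩
    have e3 : ¬ BelowEdge x y a b a := fun hh => by linarith [hh.1]
    have e4 : ¬ BelowEdge x y a b b := fun hh => by linarith [hh.2.1]
    simp [e1, e2, e3, e4]
  by_cases hov : max (x a) (x v) < min (x b) (x u)
  · obtain ⟨τ, h1, h2⟩ := exists_between hov
    rw [max_lt_iff] at h1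
    rw [lt_min_iff] at h2
    rw [h.belowLeft_add_belowEdge hab hvu hx hx' hne h1.1 h1.2 h2.1 h2.2,
      h.belowRight_add_belowEdge hab hvu hx hx' hne h1.1 h1.2 h2.1 h2.2]
  · have hd : x b ≤ x v ∨ x u ≤ x a := by
      simp only [lt_min_iff, max_lt_iff, not_and_or, not_lt] at hov
      rcases hov with (h | h) | (h | h)
      · linarith
      · exact Or.inl h
      · exact Or.inr h
      · linarith
    have e1 : ¬ BelowLeft x y v u a b := by
      rintro (⟨_, _, _⟩ | ⟨rfl, _, _⟩) <;> rcases hd with hd | hd <;> linarith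
    have e2 : ¬ BelowRight x y v u a b := by
      rintro (⟨_, _, _⟩ | ⟨rfl, _, _⟩) <;> rcases hd with hd | hd <;> linarith
    have e3 : ¬ BelowEdge x y v u a := by
      rintro ⟨_, _, _⟩
      rcases hd with hd | hd <;> linarith
    have e4 : ¬ BelowEdge x y v u b := by
      rintro ⟨_, _, _⟩
      rcases hd with hd | hd <;> linarith
    simp [e1, e2, e3, e4]

end StraightLine

/-! ### Rotation at a vertex and parities of regions -/

namespace StraightLine

variable {V : Type*} {G : SimpleGraph V} {x y : V → ℝ} {w : V → V → ZMod 2}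

/-- The sort key of the counterclockwise order, from the downward direction, of the edges `vu`
at `v`. -/
noncomputable def rotKey (x y : V → ℝ) (v u : V) : Bool ×ₗ ℝ :=
  toLex (decide (x u < x v), slopeOf x y v u)

/-- Two edges that leave `v` on the same side with the same slope overlap near `v`. -/
theorem IsPlaneDrawing.rotKey_injOn (h : IsPlaneDrawing G x y) {v c d : V} (hc : G.Adj v c)
    (hd : G.Adj v d) (hk : rotKey x y v c = rotKey x y v d) : c = d := by
  have hk' := congrArg ofLex hk
  simp only [rotKey, ofLex_toLex, Prod.mk.injEq, decide_eq_decide] at hk'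
  obtain ⟨hside, hs⟩ := hk'
  have hxc : x v ≠ x c := fun e => hc.ne (h.inj e)
  have hxd : x v ≠ x d := fun e => hd.ne (h.inj e)
  rcases lt_or_gt_of_ne hxc with h1 | h1
  · have h2 : x v < x d := by
      rcases lt_or_gt_of_ne hxd with h2 | h2
      · exact h2
      · linarith [hside.2 h2]
    obtain ⟨t, ht1, ht2⟩ := exists_between (lt_min h1 h2)
    rw [lt_min_iff] at ht2
    refine (h.edge v c v d t hc hd ht1 ht2.1 ht1 ht2.2 ?_).2
    unfold lineAt
    rw [hs]
  · have h2 := hside.1 h1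
    obtain ⟨t, ht1, ht2⟩ := exists_between (max_lt h1 h2)
    rw [max_lt_iff] at ht1
    refine (h.edge c v d v t hc.symm hd.symm ht1.1 ht2 ht1.2 ht2 ?_).1
    rw [lineAt_eq_right h1, lineAt_eq_right h2, slopeOf_comm c, slopeOf_comm d, hs]

variable [Fintype V]

/-- The indicator of an even subgraph, as a symmetric function on pairs of vertices. -/
structure IsCycleWeight (G : SimpleGraph V) (w : V → V → ZMod 2) : Prop where
  symm : ∀ a b, w a b = w b a
  supp : ∀ a b, ¬ G.Adj a b → w a b = 0
  sum : ∀ a, ∑ b, w a b = 0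

open Classical in
/-- The parity of the region just below the vertex `v`. -/
noncomputable def parityBelow (x y : V → ℝ) (w : V → V → ZMod 2) (v : V) : ZMod 2 :=
  ∑ a, ∑ b, if x a < x v ∧ x v < x b ∧ lineAt x y a b (x v) < y v then w a b else 0

open Classical in
/-- The parity of the region at `v` just counterclockwise of the edge `vu`. -/
noncomputable def parityCCW (x y : V → ℝ) (w : V → V → ZMod 2) (v u : V) : ZMod 2 :=
  parityBelow x y w v + ∑ c, if rotKey x y v c ≤ rotKey x y v u then w v c else 0

open Classical in
/-- The parity of the region at `v` just clockwise of the edge `vu`. -/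
noncomputable def parityCW (x y : V → ℝ) (w : V → V → ZMod 2) (v u : V) : ZMod 2 :=
  parityBelow x y w v + ∑ c, if rotKey x y v c < rotKey x y v u then w v c else 0

/-- Crossing an edge changes the parity by its weight, since only `u` itself has the key of `u`. -/
theorem IsPlaneDrawing.parityCCW_eq_add (h : IsPlaneDrawing G x y) (hw : IsCycleWeight G w)
    {v u : V} (hvu : G.Adj v u) : parityCCW x y w v u = parityCW x y w v u + w v u := by
  classical
  unfold parityCCW parityCW
  rw [add_assoc]
  congr 1
  have : w v u = ∑ c, if c = u then w v c else 0 := by simp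
  rw [this, ← Finset.sum_add_distrib]
  refine Finset.sum_congr rfl fun c _ => ?_
  by_cases hc : G.Adj v c
  · by_cases hcu : c = u
    · subst hcu
      simp
    · have hne : rotKey x y v c ≠ rotKey x y v u := fun e => hcu (h.rotKey_injOn hc hvu e)
      have : rotKey x y v c ≤ rotKey x y v u ↔ rotKey x y v c < rotKey x y v u :=
        ⟨fun hh => lt_of_le_of_ne hh hne, le_of_lt⟩
      simp [this, hcu]
  · simp [hw.supp v c hc]

open Classical in
-- For `u` to the right of `v`, turning counterclockwise from the downward direction to just past
-- `vu` meets exactly the rightward edges below or along `vu`. The parity thus counts edges below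
-- the region just above `vu` at `v`.
theorem IsPlaneDrawing.parityCCW_eq_sum (h : IsPlaneDrawing G x y) (hw : IsCycleWeight G w)
    {v u : V} (hx : x v < x u) : parityCCW x y w v u =
      ∑ a, ∑ b, if BelowLeft x y v u a b then w a b else 0 := by
  have key : ∀ a b, (if BelowLeft x y v u a b then w a b else 0) =
      (if x a < x v ∧ x v < x b ∧ lineAt x y a b (x v) < y v then w a b else 0) +
      (if a = v then (if rotKey x y v b ≤ rotKey x y v u then w v b else 0) else 0) := by
    intro a b
    by_cases hav : a = v
    · subst hav
      by_cases hab : G.Adj a b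
      · have hxb : x a ≠ x b := fun e => hab.ne (h.inj e)
        have : BelowLeft x y a u a b ↔ rotKey x y a b ≤ rotKey x y a u := by
          unfold BelowLeft rotKey
          rw [Prod.Lex.toLex_le_toLex]
          rcases lt_or_gt_of_ne hxb with hh | hh
          · simp [hh, hx.not_gt, hh.not_gt]
          · simp [hh, hx.not_gt, hh.not_gt]
        simp [this]
      · simp [hw.supp a b hab]
    · simp [BelowLeft, hav]
  simp_rw [key, Finset.sum_add_distrib]
  unfold parityCCW parityBelow
  congr 1
  rw [Finset.sum_comm]
  simp

open Classical in
-- The same region seen from `u`. Turning counterclockwise to just before `uv` meets the edges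
-- complementary to those entering from the left below or along `vu`; the two sums agree because the
-- weights at `u` add up to zero.
theorem IsPlaneDrawing.parityCW_eq_sum (h : IsPlaneDrawing G x y) (hw : IsCycleWeight G w)
    {v u : V} (hx : x v < x u) : parityCW x y w u v =
      ∑ a, ∑ b, if BelowRight x y v u a b then w a b else 0 := by
  have key : ∀ a b, (if BelowRight x y v u a b then w a b else 0) =
      (if x a < x u ∧ x u < x b ∧ lineAt x y a b (x u) < y u then w a b else 0) +
      (if b = u then (if rotKey x y u a < rotKey x y u v then 0 else w u a) else 0) := by
    intro a b
    by_cases hbu : b = u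
    · subst hbu
      by_cases hab : G.Adj b a
      · have hxb : x b ≠ x a := fun e => hab.ne (h.inj e)
        have : BelowRight x y v b a b ↔ ¬ rotKey x y b a < rotKey x y b v := by
          unfold BelowRight rotKey
          rw [Prod.Lex.toLex_lt_toLex]
          rcases lt_or_gt_of_ne hxb with hh | hh
          · simp [hx, hh.not_gt]
          · simp [hx, slopeOf_comm b, hh]
        by_cases hc : rotKey x y b a < rotKey x y b v <;> simp [this, hc, hw.symm a b]
      · simp [hw.supp b a hab, hw.symm a b]
    · simp [BelowRight, hbu]
  simp_rw [key, Finset.sum_add_distrib]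
  unfold parityCW parityBelow
  congr 1
  have h2 : ∀ p q : ZMod 2, p + q = 0 → p = q := by decide
  apply h2
  simp only [Finset.sum_ite_eq', Finset.mem_univ, if_true]
  rw [← Finset.sum_add_distrib]
  refine Eq.trans (Finset.sum_congr rfl fun c _ => ?_) (hw.sum u)
  split_ifs <;> simp

theorem IsPlaneDrawing.parityCCW_eq_parityCW_of_lt (h : IsPlaneDrawing G x y)
    (hw : IsCycleWeight G w) {v u : V} (hvu : G.Adj v u) (hx : x v < x u) :
    parityCCW x y w v u = parityCW x y w u v := by
  classical
  have h2 : ∀ p q : ZMod 2, p + q = 0 → p = q := by decide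
  apply h2
  rw [h.parityCCW_eq_sum hw hx, h.parityCW_eq_sum hw hx, ← Finset.sum_add_distrib]
  simp_rw [← Finset.sum_add_distrib]
  have hpt : ∀ a b, ((if BelowLeft x y v u a b then w a b else 0) +
      if BelowRight x y v u a b then w a b else 0) =
      (if x a < x b then (if BelowEdge x y v u a then w a b else 0) else 0) +
      (if x a < x b then (if BelowEdge x y v u b then w a b else 0) else 0) := by
    intro a b
    by_cases hab : G.Adj a b
    · by_cases hlt : x a < x b
      · have := congrArg (· * w a b) (h.belowLeft_add_belowRight hab hvu hlt hx)
        simpa [add_mul, hlt] using this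
      · have e1 : ¬ BelowLeft x y v u a b := by
          rintro (⟨_, _, _⟩ | ⟨rfl, _, _⟩) <;> linarith
        have e2 : ¬ BelowRight x y v u a b := by
          rintro (⟨_, _, _⟩ | ⟨rfl, _, _⟩) <;> linarith
        simp [e1, e2, hlt]
    · simp [hw.supp a b hab]
  simp_rw [hpt, Finset.sum_add_distrib]
  rw [Finset.sum_comm (f := fun a b =>
    if x a < x b then (if BelowEdge x y v u b then w a b else 0) else 0)]
  rw [← Finset.sum_add_distrib]
  refine Finset.sum_eq_zero fun a _ => ?_
  rw [← Finset.sum_add_distrib]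
  -- After regrouping by end, a vertex below `vu` contributes its rightward and leftward edges,
  -- hence the whole sum of weights at it, which is zero.
  by_cases ha : BelowEdge x y v u a
  · refine Eq.trans (Finset.sum_congr rfl fun b _ => ?_) (hw.sum a)
    by_cases hab : G.Adj a b
    · have hxb : x a ≠ x b := fun e => hab.ne (h.inj e)
      rcases lt_or_gt_of_ne hxb with hh | hh
      · simp [ha, hh, hh.not_gt]
      · simp [ha, hh, hh.not_gt, hw.symm b a]
    · simp [hw.supp a b hab, hw.symm b a]
  · simp [ha]

/-- The two ends of an edge see the same parity on either side of it. -/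
theorem IsPlaneDrawing.parityCCW_eq_parityCW (h : IsPlaneDrawing G x y)
    (hw : IsCycleWeight G w) {v u : V} (hvu : G.Adj v u) :
    parityCCW x y w v u = parityCW x y w u v := by
  have hx : x v ≠ x u := fun e => hvu.ne (h.inj e)
  rcases lt_or_gt_of_ne hx with hh | hh
  · exact h.parityCCW_eq_parityCW_of_lt hw hvu hh
  · have h1 := h.parityCCW_eq_parityCW_of_lt hw hvu.symm hh
    have h2 := h.parityCCW_eq_add hw hvu
    have h3 := h.parityCCW_eq_add hw hvu.symm
    rw [h2, ← h1, h3, hw.symm u v, add_assoc, CharTwo.add_self_eq_zero, add_zero]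

/-- The edge that precedes `uv` in the rotation at `u` bounds the same region. -/
theorem IsPlaneDrawing.exists_parityCCW_eq (h : IsPlaneDrawing G x y) {u v v' : V}
    (huv : G.Adj u v) (huv' : G.Adj u v') (hne : v' ≠ v) :
    ∃ c, G.Adj u c ∧ c ≠ v ∧
      ∀ w, IsCycleWeight G w → parityCCW x y w u c = parityCW x y w u v := by
  classical
  by_cases hex : ∃ c, G.Adj u c ∧ rotKey x y u c < rotKey x y u v
  · obtain ⟨c, hc, hmax⟩ := Finset.exists_max_image
      (Finset.univ.filter fun c => G.Adj u c ∧ rotKey x y u c < rotKey x y u v) (rotKey x y u)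
      (by obtain ⟨c, hc⟩ := hex; exact ⟨c, by simpa using hc⟩)
    simp only [Finset.mem_filter, Finset.mem_univ, true_and] at hc hmax
    refine ⟨c, hc.1, fun e => (e ▸ hc.2).ne rfl, fun w hw => ?_⟩
    unfold parityCCW parityCW
    congr 1
    refine Finset.sum_congr rfl fun d _ => ?_
    by_cases hd : G.Adj u d
    · have : rotKey x y u d ≤ rotKey x y u c ↔ rotKey x y u d < rotKey x y u v :=
        ⟨fun hh => hh.trans_lt hc.2, fun hh => hmax d ⟨hd, hh⟩⟩
      simp [this]
    · simp [hw.supp u d hd]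
  -- Here `v` comes first from the downward direction, so its cyclic predecessor is the last edge.
  -- The full turn changes nothing because the weights at `u` sum to zero; the second neighbour `v'`
  -- keeps the last edge different from `uv`.
  · push Not at hex
    obtain ⟨c, hc, hmax⟩ := Finset.exists_max_image
      (Finset.univ.filter fun c => G.Adj u c) (rotKey x y u) ⟨v, by simpa using huv⟩
    simp only [Finset.mem_filter, Finset.mem_univ, true_and] at hc hmax
    refine ⟨c, hc, ?_, fun w hw => ?_⟩
    · rintro rfl
      exact hne (h.rotKey_injOn huv' hc (le_antisymm (hmax v' huv') (hex v' huv')))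
    · unfold parityCCW parityCW
      congr 1
      rw [Finset.sum_eq_zero (s := Finset.univ)
        (f := fun d => if rotKey x y u d < rotKey x y u v then w u d else 0)]
      · refine Eq.trans (Finset.sum_congr rfl fun d _ => ?_) (hw.sum u)
        by_cases hd : G.Adj u d
        · simp [hmax d hd]
        · simp [hw.supp u d hd]
      · intro d _
        by_cases hd : G.Adj u d
        · simp [hex d hd]
        · simp [hw.supp u d hd]

/-! ### Cycle space, face classes and the edge bound -/

/-- The even edge sets of a graph number at least `2 ^ (|E| - |V|)`. -/
theorem exists_cycleWeights (G : SimpleGraph V) [Fintype G.edgeSet] :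
    ∃ C : Set (V → V → ZMod 2), (∀ w ∈ C, IsCycleWeight G w) ∧
      2 ^ (G.edgeFinset.card - Fintype.card V) ≤ Nat.card C := by
  classical
  let ext : (G.edgeSet → ZMod 2) → V → V → ZMod 2 := fun z a b =>
    if h : G.Adj a b then z ⟨s(a, b), h⟩ else 0
  -- The boundary map modulo 2: its kernel consists of the even edge sets and its rank is at most
  -- the number of vertices.
  let bd : (G.edgeSet → ZMod 2) →ₗ[ZMod 2] (V → ZMod 2) :=
    { toFun := fun z a => ∑ b, ext z a b
      map_add' := by
        intro z z'
        funext a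
        simp only [Pi.add_apply, ← Finset.sum_add_distrib]
        refine Finset.sum_congr rfl fun b _ => ?_
        by_cases h : G.Adj a b <;> simp [ext, h]
      map_smul' := by
        intro c z
        funext a
        simp only [Pi.smul_apply, smul_eq_mul, RingHom.id_apply, Finset.mul_sum]
        refine Finset.sum_congr rfl fun b _ => ?_
        by_cases h : G.Adj a b <;> simp [ext, h] }
  have hinj : Function.Injective ext := by
    intro z z' hz
    funext ⟨e, he⟩
    induction e with
    | h a b =>
      have hab : G.Adj a b := he
      have := congrFun (congrFun hz a) b
      simpa [ext, hab] using this
  refine ⟨ext '' (LinearMap.ker bd : Set (G.edgeSet → ZMod 2)), ?_, ?_⟩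
  · rintro _ ⟨z, hz, rfl⟩
    refine ⟨fun a b => ?_, fun a b hab => by simp [ext, hab], fun a => congrFun hz a⟩
    by_cases hab : G.Adj a b
    · simp [ext, hab, hab.symm, Sym2.eq_swap]
    · have hba : ¬ G.Adj b a := fun hh => hab hh.symm
      simp [ext, hab, hba]
  · rw [Nat.card_image_of_injective hinj]
    have hk : Nat.card (LinearMap.ker bd) =
        2 ^ Module.finrank (ZMod 2) (LinearMap.ker bd) := by
      rw [Nat.card_eq_fintype_card, Module.card_eq_pow_finrank (K := ZMod 2), ZMod.card]
    have hr := LinearMap.finrank_range_add_finrank_ker bd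
    have hle : Module.finrank (ZMod 2) (LinearMap.range bd) ≤ Fintype.card V := by
      simpa using Submodule.finrank_le (LinearMap.range bd)
    have hE : Module.finrank (ZMod 2) (G.edgeSet → ZMod 2) = G.edgeFinset.card := by
      rw [Module.finrank_fintype_fun_eq_card, SimpleGraph.edgeFinset_card]
    change _ ≤ Nat.card (LinearMap.ker bd)
    rw [hk]
    exact Nat.pow_le_pow_right (by norm_num) (by omega)

/-- If the first four iterates of a point are always distinct, then at most a quarter as many
classes as points are formed by identifying each point with its image. -/
theorem four_mul_card_quot_le {D : Type*} [Fintype D] (f : D → D) (h1 : ∀ d, f d ≠ d)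
    (h2 : ∀ d, f (f d) ≠ d) (h3 : ∀ d, f (f (f d)) ≠ d) :
    4 * Nat.card (Quot fun d d' => f d = d') ≤ Fintype.card D := by
  classical
  let r : D → D → Prop := fun d d' => f d = d'
  let q : D → Quot r := Quot.mk r
  have hq : ∀ d, q (f d) = q d := fun d => (Quot.sound (r := r) (a := d) (b := f d) rfl).symm
  have : Fintype (Quot r) := Fintype.ofSurjective q Quot.mk_surjective
  change 4 * Nat.card (Quot r) ≤ _
  have himg : Finset.univ.image q = Finset.univ :=
    Finset.image_univ_of_surjective Quot.mk_surjective
  rw [Nat.card_eq_fintype_card, ← Finset.card_univ, ← Finset.card_univ, ← himg]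
  refine Finset.mul_card_image_le_card _ _ fun a ha => ?_
  obtain ⟨d, -, rfl⟩ := Finset.mem_image.1 ha
  have hsub : ({d, f d, f (f d), f (f (f d))} : Finset D) ⊆ Finset.univ.filter (q · = q d) := by
    intro e he
    simp only [Finset.mem_insert, Finset.mem_singleton] at he
    rcases he with rfl | rfl | rfl | rfl <;> simp [hq]
  refine le_trans (le_of_eq ?_) (Finset.card_le_card hsub)
  rw [Finset.card_insert_of_notMem, Finset.card_insert_of_notMem, Finset.card_insert_of_notMem,
    Finset.card_singleton]
  · simpa using (h1 _).symm
  · simpa using ⟨(h1 _).symm, (h2 _).symm⟩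
  · simpa using ⟨(h1 _).symm, (h2 _).symm, (h3 _).symm⟩

/-- A triangle-free straight-line plane graph of minimum degree at least two on `m` vertices has
fewer than `2 * m` edges. -/
theorem IsPlaneDrawing.card_edgeFinset_lt [Nonempty V] [Fintype G.edgeSet]
    (h : IsPlaneDrawing G x y) (hfree : G.CliqueFree 3)
    (hdeg : ∀ v, ∃ a b, G.Adj v a ∧ G.Adj v b ∧ a ≠ b) :
    G.edgeFinset.card < 2 * Fintype.card V := by
  classical
  have hV : 0 < Fintype.card V := Fintype.card_pos
  by_contra hcon
  push Not at hcon
  -- Face tracing: from the dart `vu` go on along the edge at `u` preceding `uv`, keeping the same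
  -- region on the left. Degree two prevents turning back.
  have hnext : ∀ d : G.Dart, ∃ c, G.Adj d.snd c ∧ c ≠ d.fst ∧
      ∀ w, IsCycleWeight G w → parityCCW x y w d.snd c = parityCCW x y w d.fst d.snd := by
    intro d
    obtain ⟨v', hv', hne⟩ : ∃ v', G.Adj d.snd v' ∧ v' ≠ d.fst := by
      obtain ⟨a, b, ha, hb, hab⟩ := hdeg d.snd
      by_cases e : a = d.fst
      · exact ⟨b, hb, fun e' => hab (e.trans e'.symm)⟩
      · exact ⟨a, ha, e⟩
    obtain ⟨c, hc, hcv, hpar⟩ := h.exists_parityCCW_eq d.adj.symm hv' hne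
    exact ⟨c, hc, hcv, fun w hw => by rw [hpar w hw, h.parityCCW_eq_parityCW hw d.adj]⟩
  choose c hc hcne hpar using hnext
  let f : G.Dart → G.Dart := fun d => ⟨(d.snd, c d), hc d⟩
  -- A fixed dart would be a loop, a dart of period two a turn back, and one of period three a
  -- triangle.
  have hQ := four_mul_card_quot_le f
    (fun d hd => d.adj.ne (congrArg (fun e : G.Dart => e.fst) hd).symm)
    (fun d hd => hcne d (congrArg (fun e : G.Dart => e.fst) hd))
    (fun d hd => by
      have e1 : c (f d) = d.fst := congrArg (fun e : G.Dart => e.fst) hd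
      have a1 : G.Adj (c d) (c (f d)) := hc (f d)
      rw [e1] at a1
      exact hfree _ (SimpleGraph.is3Clique_triple_iff.2 ⟨d.adj, a1.symm, hc d⟩))
  rw [SimpleGraph.dart_card_eq_twice_card_edges] at hQ
  obtain ⟨C, hC, hcard⟩ := exists_cycleWeights G
  let r : G.Dart → G.Dart → Prop := fun d d' => f d = d'
  have hfin : Finite (Quot r) := Finite.of_surjective (Quot.mk r) Quot.mk_surjective
  -- The region colouring of an even set, with a global shift; the shift supplies the extra factor 2
  -- in the count.
  let L : C × ZMod 2 → Quot r → ZMod 2 := fun p => Quot.lift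
    (fun d => p.2 + parityCCW x y p.1.1 d.fst d.snd) (by
      rintro d _ rfl
      rw [show (f d).fst = d.snd from rfl, show (f d).snd = c d from rfl,
        hpar d _ (hC _ p.1.2)])
  have hL : Function.Injective L := by
    rintro ⟨⟨w, hw⟩, s⟩ ⟨⟨w', hw'⟩, s'⟩ heq
    have hval : ∀ a b, G.Adj a b → s + parityCCW x y w a b = s' + parityCCW x y w' a b :=
      fun a b hab => congrFun heq (Quot.mk r ⟨(a, b), hab⟩)
    -- The colours on the two sides of an edge differ by its weight, and the shift cancels.
    have hww : w = w' := by
      funext a b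
      by_cases hab : G.Adj a b
      · have h1 := hval a b hab
        have h2 := hval b a hab.symm
        rw [h.parityCCW_eq_parityCW (hC _ hw) hab, h.parityCCW_eq_parityCW (hC _ hw') hab] at h1
        rw [h.parityCCW_eq_add (hC _ hw) hab.symm, h.parityCCW_eq_add (hC _ hw') hab.symm] at h2
        rw [(hC _ hw).symm a b, (hC _ hw').symm a b]
        linear_combination h2 - h1
      · rw [(hC _ hw).supp a b hab, (hC _ hw').supp a b hab]
    subst hww
    obtain ⟨v⟩ := (inferInstance : Nonempty V)
    obtain ⟨a, -, ha, -⟩ := hdeg v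
    have := add_right_cancel (hval v a ha)
    rw [this]
  have hle := Nat.card_le_card_of_injective L hL
  rw [Nat.card_prod, Nat.card_zmod, Nat.card_fun, Nat.card_zmod] at hle
  have hpow : 2 ^ (G.edgeFinset.card - Fintype.card V + 1) ≤ 2 ^ Nat.card (Quot r) := by
    rw [pow_succ]
    exact (Nat.mul_le_mul_right 2 hcard).trans hle
  have hexp := (Nat.pow_le_pow_iff_right (by norm_num)).1 hpow
  have hQ' : 4 * Nat.card (Quot r) ≤ 2 * G.edgeFinset.card := by convert hQ
  omega

end StraightLine

/-! ### From geometric graphs to drawings, and the bound 3 -/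

/-- Each pair of points at different heights excludes one value of `t`, and points at equal height
remain apart under every shear. -/
theorem exists_injOn_shear (S : Finset Plane) :
    ∃ t : ℝ, Function.Injective fun v : S => (v : Plane) 0 + t * (v : Plane) 1 := by
  classical
  obtain ⟨t, ht⟩ := Infinite.exists_notMem_finset
    ((S ×ˢ S).image fun p => -(p.1 0 - p.2 0) / (p.1 1 - p.2 1))
  refine ⟨t, fun v w hvw => ?_⟩
  simp only at hvw
  by_cases h1 : (v : Plane) 1 = (w : Plane) 1
  · apply Subtype.ext
    ext i
    fin_cases i
    · show (v : Plane) 0 = (w : Plane) 0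
      rw [h1] at hvw
      linarith
    · exact h1
  · exfalso
    refine ht (Finset.mem_image.2 ⟨(v, w), by simp, ?_⟩)
    have : (v : Plane) 1 - (w : Plane) 1 ≠ 0 := sub_ne_zero.2 h1
    field_simp
    linarith

open StraightLine in
-- The shear keeps lines and the second coordinate. General position keeps vertices off edges, and a
-- common height of two edges over one abscissa is a common interior point.
theorem isPlaneDrawing_of_isNonCrossing {S : Finset Plane} (hS : InGeneralPosition S)
    {G : SimpleGraph S} (hG : IsNonCrossing G) {t : ℝ}
    (ht : Function.Injective fun v : S => (v : Plane) 0 + t * (v : Plane) 1) :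
    IsPlaneDrawing G (fun v => (v : Plane) 0 + t * (v : Plane) 1) fun v => (v : Plane) 1 := by
  set x : S → ℝ := fun v => (v : Plane) 0 + t * (v : Plane) 1 with hx
  set y : S → ℝ := fun v => (v : Plane) 1 with hy
  have hmem : ∀ a b τ, x a < τ → τ < x b → ∃ p ∈ openSegment ℝ (a : Plane) (b : Plane),
      p 0 = τ - t * lineAt x y a b τ ∧ p 1 = lineAt x y a b τ := by
    intro a b τ h1 h2
    have h3 : 0 < x b - x a := by linarith
    refine ⟨((x b - τ) / (x b - x a)) • (a : Plane) + ((τ - x a) / (x b - x a)) • (b : Plane),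
      ⟨_, _, div_pos (by linarith) h3, div_pos (by linarith) h3, ?_, rfl⟩, ?_, ?_⟩
    · rw [← add_div]
      rw [show x b - τ + (τ - x a) = x b - x a by ring, div_self h3.ne']
    · have e1 : (a : Plane) 0 = x a - t * y a := by simp [hx, hy]
      have e2 : (b : Plane) 0 = x b - t * y b := by simp [hx, hy]
      simp only [PiLp.add_apply, PiLp.smul_apply, smul_eq_mul, e1, e2, lineAt, slopeOf]
      field_simp
      ring
    · have e1 : (a : Plane) 1 = y a := rfl
      have e2 : (b : Plane) 1 = y b := rfl
      simp only [PiLp.add_apply, PiLp.smul_apply, smul_eq_mul, e1, e2, lineAt, slopeOf]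
      field_simp
      ring
  refine ⟨ht, ?_, ?_⟩
  · intro a b c hab h1 h2 heq
    have hac : a ≠ c := by
      rintro rfl
      exact lt_irrefl _ h1
    have hbc : b ≠ c := by
      rintro rfl
      exact lt_irrefl _ h2
    refine hS a a.2 b b.2 c c.2 (fun e => hab.ne (Subtype.ext e))
      (fun e => hac (Subtype.ext e)) (fun e => hbc (Subtype.ext e))
      (collinear_of_orient_eq_zero ?_)
    have h3 : x b - x a ≠ 0 := by linarith
    unfold lineAt slopeOf at heq
    field_simp at heq
    simp only [hx, hy] at heq
    unfold orient
    linear_combination heq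
  · intro a b c d τ hab hcd h1 h2 h3 h4 heq
    obtain ⟨p, hp, hp0, hp1⟩ := hmem a b τ h1 h2
    obtain ⟨q, hq, hq0, hq1⟩ := hmem c d τ h3 h4
    have hpq : p = q := by
      ext i
      fin_cases i
      · show p 0 = q 0
        rw [hp0, hq0, heq]
      · show p 1 = q 1
        rw [hp1, hq1, heq]
    by_cases hs : s(a, b) = s(c, d)
    · rcases Sym2.eq_iff.1 hs with h | ⟨rfl, rfl⟩
      · exact h
      · linarith
    · exact absurd (hpq ▸ hq) (Set.disjoint_left.1 (hG a b c d hab hcd hs) hp)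

theorem le_three_of_mem_packingSizes {S : Finset Plane} (hS : InGeneralPosition S)
    (hne : S.Nonempty) {k : ℕ} (hk : k ∈ packingSizes S) : k ≤ 3 := by
  classical
  obtain ⟨F, hF⟩ := hk
  by_contra hcon
  push Not at hcon
  have hnonempty : Nonempty S := hne.to_subtype
  have hdeg : ∀ v, k ≤ (unionGraph F).degree v := by
    intro v
    obtain ⟨f, hf, hadj⟩ := exists_injective_adj_unionGraph hF v
    have := Finset.card_le_card_of_injOn (s := Finset.univ)
      (t := (unionGraph F).neighborFinset v) f (fun i _ => by simpa using hadj i) hf.injOn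
    simpa using this
  obtain ⟨t, ht⟩ := exists_injOn_shear S
  have hlt := (isPlaneDrawing_of_isNonCrossing hS hF.plane ht).card_edgeFinset_lt hF.triangleFree
    (fun v => by
      obtain ⟨f, hf, hadj⟩ := exists_injective_adj_unionGraph hF v
      refine ⟨f ⟨0, by omega⟩, f ⟨1, by omega⟩, hadj _, hadj _, fun e => ?_⟩
      simpa using hf e)
  have hsum := (unionGraph F).sum_degrees_eq_twice_card_edges
  have h4 : Fintype.card S * 4 ≤ ∑ v, (unionGraph F).degree v := by
    rw [← smul_eq_mul, ← Finset.card_univ]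
    exact Finset.card_nsmul_le_sum _ _ _ fun v _ => by
      have := hdeg v
      omega
  omega

/-! ### Polygonizations and packings of two matchings -/

theorem orient_mem_openSegment {p q a b z : Plane} (h : z ∈ openSegment ℝ a b) :
    ∃ s t : ℝ, 0 < s ∧ 0 < t ∧ orient p q z = s * orient p q a + t * orient p q b := by
  obtain ⟨s, t, hs, ht, hst, h0, h1⟩ := mem_openSegment_coord h
  refine ⟨s, t, hs, ht, ?_⟩
  have : s = 1 - t := by linarith
  subst this
  unfold orient
  rw [h0, h1]
  ring

theorem orient_swap (p q r : Plane) : orient p q r = -orient p r q := by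
  unfold orient
  ring

/-- The pairs `i < j` of indices that are joined in the cycle `0, 1, …, N - 1`. -/
def IsCycleEdge {N : ℕ} (i j : Fin N) : Prop :=
  i.val + 1 = j.val ∨ (i.val = 0 ∧ j.val + 1 = N ∧ 2 < N)

/-- The polygon is star-shaped from `P o`: a line through `P o` and another vertex separates any two
sides. -/
theorem disjoint_openSegment_of_orient_pos {N : ℕ} {P : Fin N → Plane} {o : Fin N}
    (ho : o.val = 0) (hP : ∀ i j, o < i → i < j → 0 < orient (P o) (P i) (P j)) {i j k l : Fin N}
    (hij : IsCycleEdge i j) (hkl : IsCycleEdge k l) (hlt : i < k ∨ (i = k ∧ j < l)) :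
    Disjoint (openSegment ℝ (P i) (P j)) (openSegment ℝ (P k) (P l)) := by
  have hP' : ∀ i j, o < j → j < i → orient (P o) (P i) (P j) < 0 := by
    intro i j h1 h2
    rw [orient_swap]
    have := hP j i h1 h2
    linarith
  have hself : ∀ i, orient (P o) (P i) (P i) = 0 := by
    intro i
    unfold orient
    ring
  have hzero : ∀ i, orient (P o) (P i) (P o) = 0 := by
    intro i
    unfold orient
    ring
  rw [Set.disjoint_left]
  intro z hz hz'
  unfold IsCycleEdge at hij hkl
  -- A common point is a positive combination of either pair of ends, so the two combinations of
  -- orientations agree for every `q`; a suitable `q` gives contradictory signs.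
  have hsep : ∀ q, ∃ s t s' t' : ℝ, 0 < s ∧ 0 < t ∧ 0 < s' ∧ 0 < t' ∧
      s * orient (P o) q (P i) + t * orient (P o) q (P j) =
        s' * orient (P o) q (P k) + t' * orient (P o) q (P l) := by
    intro q
    obtain ⟨s, t, hs, ht, h⟩ := orient_mem_openSegment (p := P o) (q := q) hz
    obtain ⟨s', t', hs', ht', h'⟩ := orient_mem_openSegment (p := P o) (q := q) hz'
    exact ⟨s, t, s', t', hs, ht, hs', ht', h ▸ h'⟩
  -- A side at `P o` lies on the line towards `P j`, and the other side is weakly on one side of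
  -- that line with an end strictly off it.
  by_cases hi : i = o
  · subst hi
    rcases hlt with hlt | ⟨rfl, hlt⟩
    · have hkl' : k < l := by
        rw [Fin.lt_def] at *
        omega
      obtain ⟨s, t, s', t', hs, ht, hs', ht', h⟩ := hsep (P j)
      rw [hzero, hself] at h
      have hl := hlt.trans hkl'
      have hj : i < j := by
        rw [Fin.lt_def] at *
        omega
      rcases lt_trichotomy j k with hjk | hjk | hjk
      · have := hP j k hj hjk
        have := hP j l hj (hjk.trans hkl')
        nlinarith [mul_pos hs' (hP j k hj hjk), mul_pos ht' (hP j l hj (hjk.trans hkl'))]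
      · subst hjk
        rw [hself] at h
        nlinarith [mul_pos ht' (hP j l hj hkl')]
      · rcases lt_trichotomy j l with hjl | hjl | hjl
        · rw [Fin.lt_def] at *
          omega
        · subst hjl
          rw [hself] at h
          nlinarith [mul_pos hs' (neg_pos.2 (hP' j k hlt hjk))]
        · nlinarith [mul_pos hs' (neg_pos.2 (hP' j k hlt hjk)),
            mul_pos ht' (neg_pos.2 (hP' j l hl hjl))]
    · obtain ⟨s, t, s', t', hs, ht, hs', ht', h⟩ := hsep (P j)
      have hj : i < j := by
        rw [Fin.lt_def] at *
        omega
      rw [hzero, hself] at h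
      nlinarith [mul_pos ht' (hP j l hj hlt)]
  · have hi' : o < i := by
      rw [Fin.lt_def]
      rw [Fin.ext_iff] at hi
      omega
    have hik : i < k := by
      rcases hlt with hlt | ⟨rfl, hlt⟩
      · exact hlt
      · rw [Fin.lt_def] at *
        omega
    have hkl' : k < l := by
      rw [Fin.lt_def] at *
      omega
    have hoj : o < j := by
      rw [Fin.lt_def] at *
      omega
    have hjk : j ≤ k := by
      rw [Fin.lt_def] at *
      rw [Fin.le_def]
      omega
    -- Now neither side contains `P o` and `j ≤ k`, so the line towards `P k` has one side clockwise
    -- of it and the other counterclockwise.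
    obtain ⟨s, t, s', t', hs, ht, hs', ht', h⟩ := hsep (P k)
    rw [hself k] at h
    have h1 := mul_pos hs (neg_pos.2 (hP' k i hi' hik))
    have h2 := mul_pos ht' (hP k l (hi'.trans hik) hkl')
    rcases hjk.lt_or_eq with hjk | hjk
    · nlinarith [mul_pos ht (neg_pos.2 (hP' k j hoj hjk))]
    · subst hjk
      rw [hself] at h
      linarith

/-- The points of a set in general position other than a suitable one of them can be ordered by
their directions from that point. -/
theorem exists_angular_order {S : Finset Plane} (hS : InGeneralPosition S) {M : ℕ}
    (hM : S.card = M + 1) : ∃ p ∈ S, ∃ f : Fin M → Plane, (∀ i, f i ∈ S ∧ f i ≠ p) ∧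
      ∀ i j, i < j → 0 < orient p (f i) (f j) := by
  classical
  obtain ⟨p, hp, hmax⟩ := Finset.exists_max_image S (fun q => q 0 ^ 2 + q 1 ^ 2)
    (Finset.card_pos.1 (by omega))
  -- `A` and `B` are the inner product of `p` with `p - q` and the cross product of `p` with `q -
  -- p`. Maximality of the norm of `p` makes `A` positive, so the ratio `B / A` determines the angle
  -- monotonically.
  let A : Plane → ℝ := fun q => p 0 * (p 0 - q 0) + p 1 * (p 1 - q 1)
  let B : Plane → ℝ := fun q => p 0 * (q 1 - p 1) - p 1 * (q 0 - p 0)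
  have hA : ∀ q ∈ S, q ≠ p → 0 < A q := by
    intro q hq hqp
    have hd : 0 < (q 0 - p 0) ^ 2 + (q 1 - p 1) ^ 2 := by
      by_contra hcon
      apply hqp
      ext i
      fin_cases i
      · show q 0 = p 0
        nlinarith [sq_nonneg (q 0 - p 0), sq_nonneg (q 1 - p 1)]
      · show q 1 = p 1
        nlinarith [sq_nonneg (q 0 - p 0), sq_nonneg (q 1 - p 1)]
    have := hmax q hq
    simp only [A]
    nlinarith
  have hAB : ∀ q r, (p 0 ^ 2 + p 1 ^ 2) * orient p q r = A r * B q - A q * B r := by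
    intro q r
    simp only [A, B, orient]
    ring
  have hpos : ∀ q ∈ S, q ≠ p → 0 < p 0 ^ 2 + p 1 ^ 2 := by
    intro q hq hqp
    have h1 := hA q hq hqp
    by_contra hcon
    have h0 : p 0 = 0 := by nlinarith [sq_nonneg (p 0), sq_nonneg (p 1)]
    have h0' : p 1 = 0 := by nlinarith [sq_nonneg (p 0), sq_nonneg (p 1)]
    simp [A, h0, h0'] at h1
  let σ : Plane → ℝ := fun q => -(B q / A q)
  have hσ : ∀ q ∈ S, q ≠ p → ∀ r ∈ S, r ≠ p → σ q < σ r → 0 < orient p q r := by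
    intro q hq hqp r hr hrp hlt
    have h1 := hA q hq hqp
    have h2 := hA r hr hrp
    simp only [σ, neg_lt_neg_iff] at hlt
    rw [div_lt_div_iff₀ h2 h1] at hlt
    have h3 := hAB q r
    have h4 : 0 < (p 0 ^ 2 + p 1 ^ 2) * orient p q r := by linarith
    exact (pos_iff_pos_of_mul_pos h4).1 (hpos q hq hqp)
  have hinj : Set.InjOn σ (S.erase p) := by
    intro q hq r hr hqr
    simp only [Finset.coe_erase, Set.mem_sdiff, Finset.mem_coe, Set.mem_singleton_iff] at hq hr
    by_contra hne
    refine hS p hp q hq.1 r hr.1 (fun e => hq.2 e.symm) (fun e => hr.2 e.symm) hne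
      (collinear_of_orient_eq_zero ?_)
    have h1 := hA q hq.1 hq.2
    have h2 := hA r hr.1 hr.2
    simp only [σ, neg_inj] at hqr
    rw [div_eq_div_iff h1.ne' h2.ne'] at hqr
    have h3 := hAB q r
    have h4 : (p 0 ^ 2 + p 1 ^ 2) * orient p q r = 0 := by linarith
    exact (mul_eq_zero.1 h4).resolve_left (hpos q hq.1 hq.2).ne'
  have hcard : ((S.erase p).image σ).card = M := by
    rw [Finset.card_image_of_injOn hinj, Finset.card_erase_of_mem hp, hM]
    rfl
  have hex : ∀ i, ∃ q ∈ S.erase p, σ q = ((S.erase p).image σ).orderEmbOfFin hcard i :=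
    fun i => Finset.mem_image.1 (Finset.orderEmbOfFin_mem _ hcard i)
  choose f hf hfσ using hex
  have hf' : ∀ i, f i ∈ S ∧ f i ≠ p := fun i => (Finset.mem_erase.1 (hf i)).symm
  refine ⟨p, hp, f, hf', fun i j hij => hσ _ (hf' i).1 (hf' i).2 _ (hf' j).1 (hf' j).2 ?_⟩
  rw [hfσ, hfσ]
  exact (OrderEmbedding.lt_iff_lt _).2 hij

/-- Every finite set in general position is the vertex set of a simple polygon. -/
theorem exists_polygonization {S : Finset Plane} (hS : InGeneralPosition S) {N : ℕ}
    (hN : S.card = N) (hpos : 0 < N) : ∃ e : Fin N ≃ S, ∀ i j k l, IsCycleEdge i j →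
      IsCycleEdge k l → s(i, j) ≠ s(k, l) →
      Disjoint (openSegment ℝ (e i : Plane) (e j)) (openSegment ℝ (e k : Plane) (e l)) := by
  obtain ⟨M, rfl⟩ : ∃ M, N = M + 1 := ⟨N - 1, by omega⟩
  obtain ⟨p, hp, f, hf, hor⟩ := exists_angular_order hS hN
  let P : Fin (M + 1) → S := Fin.cons ⟨p, hp⟩ fun i => ⟨f i, (hf i).1⟩
  have hP : ∀ i j : Fin (M + 1), 0 < i → i < j → 0 < orient (P 0) (P i) (P j) := by
    intro i j hi hij
    obtain ⟨i, rfl⟩ := Fin.exists_succ_eq.2 hi.ne'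
    obtain ⟨j, rfl⟩ := Fin.exists_succ_eq.2 (hi.trans hij).ne'
    exact hor i j (Fin.succ_lt_succ_iff.1 hij)
  have hPinj : Function.Injective P := by
    have key : ∀ i j, i < j → P i ≠ P j := by
      intro i j hij heq
      by_cases hi : i = 0
      · subst hi
        obtain ⟨j, rfl⟩ := Fin.exists_succ_eq.2 hij.ne'
        exact (hf j).2 (congrArg Subtype.val heq).symm
      · have := hP i j (Fin.pos_of_ne_zero hi) hij
        rw [heq] at this
        unfold orient at this
        linarith
    intro i j heq
    by_contra hne
    rcases lt_or_gt_of_ne hne with h | h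
    · exact key i j h heq
    · exact key j i h heq.symm
  have hbij : Function.Bijective P :=
    (Fintype.bijective_iff_injective_and_card P).2 ⟨hPinj, by simp [hN]⟩
  refine ⟨Equiv.ofBijective P hbij, fun i j k l hij hkl hne => ?_⟩
  simp only [Equiv.ofBijective_apply]
  have hP' : ∀ i j : Fin (M + 1), 0 < i → i < j →
    0 < orient ((fun i => (P i : Plane)) 0) ((fun i => (P i : Plane)) i)
      ((fun i => (P i : Plane)) j) := hP
  rcases lt_trichotomy i k with hik | hik | hik
  · exact disjoint_openSegment_of_orient_pos (by simp) hP' hij hkl (Or.inl hik)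
  · rcases lt_trichotomy j l with hjl | hjl | hjl
    · exact disjoint_openSegment_of_orient_pos (by simp) hP' hij hkl (Or.inr ⟨hik, hjl⟩)
    · exact absurd (by rw [hik, hjl]) hne
    · exact (disjoint_openSegment_of_orient_pos (by simp) hP' hkl hij
        (Or.inr ⟨hik.symm, hjl⟩)).symm
  · exact (disjoint_openSegment_of_orient_pos (by simp) hP' hkl hij (Or.inl hik)).symm

/-- The partner of a vertex in one of the two perfect matchings of a cycle of even length. -/
def cyclePartner (n : ℕ) (c : Fin 2) (i : Fin (2 * n)) : Fin (2 * n) :=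
  if i.val % 2 = c.val then
    if h : i.val + 1 < 2 * n then ⟨i.val + 1, h⟩ else ⟨0, by omega⟩
  else if i.val = 0 then ⟨2 * n - 1, by have := i.isLt; omega⟩ else ⟨i.val - 1, by omega⟩

theorem cyclePartner_val (n : ℕ) (c : Fin 2) (i : Fin (2 * n)) :
    (cyclePartner n c i).val = if i.val % 2 = c.val then
      (if i.val + 1 < 2 * n then i.val + 1 else 0)
      else if i.val = 0 then 2 * n - 1 else i.val - 1 := by
  unfold cyclePartner
  split_ifs <;> rfl

/-- The sides of a simple polygon with `2n` vertices split alternately into two perfect matchings; a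
cycle of length at least four has no triangle. -/
theorem two_mem_packingSizes {S : Finset Plane} (hS : InGeneralPosition S) {n : ℕ} (hn : 2 ≤ n)
    (hcard : S.card = 2 * n) : 2 ∈ packingSizes S := by
  obtain ⟨e, he⟩ := exists_polygonization hS hcard (by omega)
  let G : SimpleGraph (Fin (2 * n)) :=
    { Adj := fun i j => IsCycleEdge i j ∨ IsCycleEdge j i
      symm := ⟨fun _ _ h => h.symm⟩
      loopless := ⟨fun i h => by
        unfold IsCycleEdge at h
        omega⟩ }
  refine (exists_packing_of_involutions e (cyclePartner n) ?_ ?_ ?_ G ?_ ?_ ?_).imp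
    fun _ hF => hF.1
  · intro c v
    have := c.2
    have := v.2
    have h1 := cyclePartner_val n c v
    generalize cyclePartner n c v = w at h1 ⊢
    ext
    rw [cyclePartner_val]
    split_ifs at h1 ⊢ <;> omega
  · intro c v h
    rw [Fin.ext_iff, cyclePartner_val] at h
    have := c.2
    have := v.2
    split_ifs at h <;> omega
  · intro c d v h
    rw [Fin.ext_iff, cyclePartner_val, cyclePartner_val] at h
    ext
    have := c.2
    have := d.2
    have := v.2
    split_ifs at h <;> omega
  · intro u v
    have := u.2
    have := v.2
    simp only [G, IsCycleEdge, Fin.exists_fin_two, Fin.ext_iff, cyclePartner_val, Fin.val_zero,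
      Fin.val_one]
    split_ifs <;> omega
  · intro s hs
    obtain ⟨a, b, c, hab, hac, hbc, -⟩ := SimpleGraph.is3Clique_iff.1 hs
    simp only [G, IsCycleEdge] at hab hac hbc
    omega
  · rintro a b c d (hab | hab) (hcd | hcd) hne
    · exact he a b c d hab hcd hne
    · rw [openSegment_symm ℝ (e c : Plane)]
      exact he a b d c hab hcd (by rwa [Sym2.eq_swap (a := d)])
    · rw [openSegment_symm ℝ (e a : Plane)]
      exact he b a c d hab hcd (by rwa [Sym2.eq_swap (a := b)])
    · rw [openSegment_symm ℝ (e a : Plane), openSegment_symm ℝ (e c : Plane)]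
      exact he b a d c hab hcd (by rwa [Sym2.eq_swap (a := b), Sym2.eq_swap (a := d)])

/-! ### Points in convex position -/

theorem exists_finset_equiv {V : Type*} [Fintype V] {P : V → Plane} (hP : Function.Injective P) :
    ∃ S : Finset Plane, S.card = Fintype.card V ∧ ∃ e : V ≃ S, ∀ v, (e v : Plane) = P v := by
  classical
  refine ⟨Finset.univ.image P, by rw [Finset.card_image_of_injective _ hP, Finset.card_univ],
    Equiv.ofBijective (fun v => ⟨P v, by simp⟩) ⟨?_, ?_⟩, fun v => rfl⟩
  · intro v w h
    exact hP (congrArg Subtype.val h)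
  · rintro ⟨p, hp⟩
    obtain ⟨v, -, rfl⟩ := Finset.mem_image.1 hp
    exact ⟨v, rfl⟩

theorem inGeneralPosition_of_equiv {V : Type*} {S : Finset Plane} (e : V ≃ S)
    (h : ∀ a b c, a ≠ b → a ≠ c → b ≠ c → orient (e a) (e b) (e c) ≠ 0) :
    InGeneralPosition S := by
  intro a ha b hb c hc hab hac hbc hcol
  obtain ⟨u, hu⟩ := e.surjective ⟨a, ha⟩
  obtain ⟨v, hv⟩ := e.surjective ⟨b, hb⟩
  obtain ⟨w, hw⟩ := e.surjective ⟨c, hc⟩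
  refine h u v w ?_ ?_ ?_ ?_
  · rintro rfl
    exact hab (congrArg Subtype.val (hu.symm.trans hv))
  · rintro rfl
    exact hac (congrArg Subtype.val (hu.symm.trans hw))
  · rintro rfl
    exact hbc (congrArg Subtype.val (hv.symm.trans hw))
  · rw [hu, hv, hw]
    exact orient_eq_zero_of_collinear hcol

theorem mem_openSegment_of_parabola {p q : Plane} (hp : p 1 = p 0 ^ 2) (hq : q 1 = q 0 ^ 2)
    {t : ℝ} (h1 : p 0 < t) (h2 : t < q 0) :
    !₂[t, (p 0 + q 0) * t - p 0 * q 0] ∈ openSegment ℝ p q := by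
  have h3 : 0 < q 0 - p 0 := by linarith
  refine ⟨(q 0 - t) / (q 0 - p 0), (t - p 0) / (q 0 - p 0), div_pos (by linarith) h3,
    div_pos (by linarith) h3, ?_, ?_⟩
  · field_simp
    ring
  · ext i
    fin_cases i
    · simp
      field_simp
      ring
    · simp [hp, hq]
      field_simp
      ring

/-- Two chords of a parabola whose ends alternate cross. -/
theorem not_disjoint_of_parabola {p q r s : Plane} (hp : p 1 = p 0 ^ 2) (hq : q 1 = q 0 ^ 2)
    (hr : r 1 = r 0 ^ 2) (hs : s 1 = s 0 ^ 2) (h1 : p 0 < r 0) (h2 : r 0 < q 0)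
    (h3 : q 0 < s 0) : ¬ Disjoint (openSegment ℝ p q) (openSegment ℝ r s) := by
  have hD : 0 < r 0 + s 0 - p 0 - q 0 := by linarith
  -- The abscissa where the lines of the two chords meet; the chord line through `p` and `q` has
  -- height `(p 0 + q 0) * t - p 0 * q 0`.
  obtain ⟨t, ht⟩ : ∃ t, t = (r 0 * s 0 - p 0 * q 0) / (r 0 + s 0 - p 0 - q 0) := ⟨_, rfl⟩
  have ht1 : r 0 < t := by
    rw [ht, lt_div_iff₀ hD]
    nlinarith [mul_pos (sub_pos.2 h1) (sub_pos.2 h2)]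
  have ht2 : t < q 0 := by
    rw [ht, div_lt_iff₀ hD]
    nlinarith [mul_pos (sub_pos.2 h2) (sub_pos.2 h3)]
  have heq : (p 0 + q 0) * t - p 0 * q 0 = (r 0 + s 0) * t - r 0 * s 0 := by
    rw [ht]
    field_simp
    ring
  refine Set.not_disjoint_iff.2 ⟨_, mem_openSegment_of_parabola hp hq (h1.trans ht1) ht2, ?_⟩
  rw [heq]
  exact mem_openSegment_of_parabola hr hs ht1 (ht2.trans h3)

/-- Plane graphs on points in convex position have a vertex of degree at most two. Triangle-freeness
plays no part. -/
theorem le_two_of_mem_packingSizes {N : ℕ} (hN : 3 ≤ N) {S : Finset Plane} (e : Fin N ≃ S)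
    (he0 : ∀ i, (e i : Plane) 0 = i.val) (he1 : ∀ i, (e i : Plane) 1 = (e i : Plane) 0 ^ 2)
    {k : ℕ} (hk : k ∈ packingSizes S) : k ≤ 2 := by
  classical
  obtain ⟨F, hF⟩ := hk
  by_contra hcon
  push Not at hcon
  let G := (unionGraph F).comap e
  have hnb : ∀ i, ∃ a b c, G.Adj i a ∧ G.Adj i b ∧ G.Adj i c ∧ a ≠ b ∧ a ≠ c ∧ b ≠ c := by
    intro i
    obtain ⟨f, hf, hadj⟩ := exists_injective_adj_unionGraph hF (e i)
    refine ⟨e.symm (f ⟨0, by omega⟩), e.symm (f ⟨1, by omega⟩), e.symm (f ⟨2, by omega⟩),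
      ?_, ?_, ?_, ?_, ?_, ?_⟩
    · simpa [G] using hadj _
    · simpa [G] using hadj _
    · simpa [G] using hadj _
    all_goals
      intro hh
      simpa using hf (e.symm.injective hh)
  have hcross : ∀ a b c d, G.Adj a b → G.Adj c d → a < c → c < b → b < d → False := by
    intro a b c d hab hcd h1 h2 h3
    refine not_disjoint_of_parabola (he1 a) (he1 b) (he1 c) (he1 d) ?_ ?_ ?_
      (hF.plane _ _ _ _ hab hcd ?_)
    · rw [he0, he0]
      exact Nat.cast_lt.2 h1
    · rw [he0, he0]
      exact Nat.cast_lt.2 h2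
    · rw [he0, he0]
      exact Nat.cast_lt.2 h3
    · intro hh
      rcases Sym2.eq_iff.1 hh with ⟨hh, -⟩ | ⟨hh, -⟩
      · exact h1.ne (e.injective (Subtype.ext (congrArg Subtype.val hh)))
      · exact (h1.trans (h2.trans h3)).ne (e.injective (Subtype.ext (congrArg Subtype.val hh)))
  let T := Finset.univ.filter fun p : Fin N × Fin N => G.Adj p.1 p.2 ∧ p.1.val + 2 ≤ p.2.val
  have hT : T.Nonempty := by
    obtain ⟨a, b, c, ha, hb, hc, hab, hac, hbc⟩ := hnb ⟨0, by omega⟩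
    have h1 := ha.ne
    have h2 := hb.ne
    have h3 := hc.ne
    simp only [ne_eq, Fin.ext_iff] at h1 h2 h3 hab hac hbc
    by_cases h4 : 2 ≤ a.val
    · exact ⟨(⟨0, by omega⟩, a), by simp [T, ha, h4]⟩
    by_cases h5 : 2 ≤ b.val
    · exact ⟨(⟨0, by omega⟩, b), by simp [T, hb, h5]⟩
    omega
  -- A chord that skips at least one vertex and spans the fewest indices. Edges at `c = a + 1`
  -- cannot cross it, and one reaching beyond `c + 1` would be a shorter such chord, so only `a` and
  -- `a + 2` can be neighbours of `c`.
  obtain ⟨⟨a, b⟩, hab, hmin⟩ := Finset.exists_min_image T (fun p => p.2.val - p.1.val) hT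
  simp only [T, Finset.mem_filter, Finset.mem_univ, true_and, Prod.forall] at hab hmin
  obtain ⟨hab, hlt⟩ := hab
  obtain ⟨c, hc⟩ : ∃ c : Fin N, c.val = a.val + 1 := ⟨⟨a.val + 1, by omega⟩, rfl⟩
  have hd : ∀ d, G.Adj c d → d.val = a.val ∨ d.val = a.val + 2 := by
    intro d hcd
    have hne : c.val ≠ d.val := fun hh => hcd.ne (Fin.ext hh)
    by_cases h1 : d < a
    · exact (hcross d c a b hcd.symm hab h1 (by rw [Fin.lt_def]; omega)
        (by rw [Fin.lt_def]; omega)).elim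
    by_cases h2 : b < d
    · exact (hcross a b c d hab hcd (by rw [Fin.lt_def]; omega) (by rw [Fin.lt_def]; omega)
        h2).elim
    rw [Fin.lt_def] at h1 h2
    by_cases h3 : c.val + 2 ≤ d.val
    · have := hmin c d ⟨hcd, h3⟩
      omega
    · omega
  obtain ⟨u, v, w, hu, hv, hw, huv, huw, hvw⟩ := hnb c
  have h1 := hd u hu
  have h2 := hd v hv
  have h3 := hd w hw
  simp only [ne_eq, Fin.ext_iff] at huv huw hvw
  omega

theorem exists_isGreatest_packingSizes_two (n : ℕ) (hn : 2 ≤ n) :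
    ∃ S : Finset Plane, S.card = 2 * n ∧ InGeneralPosition S ∧
      IsGreatest (packingSizes S) 2 := by
  let P : Fin (2 * n) → Plane := fun i => !₂[(i.val : ℝ), (i.val : ℝ) ^ 2]
  have hP : Function.Injective P := by
    intro i j hij
    have := congrArg (fun p : Plane => p 0) hij
    simpa [P, Fin.ext_iff] using this
  obtain ⟨S, hcard, e, he⟩ := exists_finset_equiv hP
  rw [Fintype.card_fin] at hcard
  have hgp : InGeneralPosition S := by
    refine inGeneralPosition_of_equiv e fun a b c hab hac hbc => ?_
    rw [he, he, he]
    have : orient (P a) (P b) (P c) = ((b.val : ℝ) - a.val) * (c.val - a.val) * (c.val - b.val) := by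
      simp [orient, P]
      ring
    rw [this]
    have hsub : ∀ i j : Fin (2 * n), i ≠ j → ((j.val : ℝ) - i.val) ≠ 0 := by
      intro i j hij h
      exact hij (Fin.ext (by exact_mod_cast (sub_eq_zero.1 h).symm))
    exact mul_ne_zero (mul_ne_zero (hsub a b hab) (hsub a c hac)) (hsub b c hbc)
  refine ⟨S, hcard, hgp, two_mem_packingSizes hgp hn hcard, fun k hk => ?_⟩
  exact le_two_of_mem_packingSizes (by omega) e (fun i => by simp [he, P])
    (fun i => by simp [he, P]) hk

/-! ### A plane drawing of the prism -/

theorem cycleGraph_adj_iff {n : ℕ} (hn : 3 ≤ n) (i j : Fin n) :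
    (SimpleGraph.cycleGraph n).Adj i j ↔ IsCycleEdge i j ∨ IsCycleEdge j i := by
  have hsub : ∀ i j : Fin n, (i - j).val = if j.val ≤ i.val then i.val - j.val
      else n + i.val - j.val := by
    intro i j
    split_ifs with h
    · exact Fin.coe_sub_iff_le.2 h
    · exact Fin.coe_sub_iff_lt.2 (by rw [Fin.lt_def]; omega)
  rw [SimpleGraph.cycleGraph_adj', hsub, hsub]
  unfold IsCycleEdge
  split_ifs <;> omega

/-- The successor of a vertex along a cycle. -/
def cycleNext {n : ℕ} (i : Fin n) : Fin n :=
  if h : i.val + 1 < n then ⟨i.val + 1, h⟩ else ⟨0, by omega⟩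

/-- The predecessor of a vertex along a cycle. -/
def cyclePrev {n : ℕ} (i : Fin n) : Fin n :=
  if i.val = 0 then ⟨n - 1, by have := i.isLt; omega⟩ else ⟨i.val - 1, by omega⟩

theorem cycleNext_val {n : ℕ} (i : Fin n) :
    (cycleNext i).val = if i.val + 1 < n then i.val + 1 else 0 := by
  unfold cycleNext
  split_ifs <;> rfl

theorem cyclePrev_val {n : ℕ} (i : Fin n) :
    (cyclePrev i).val = if i.val = 0 then n - 1 else i.val - 1 := by
  unfold cyclePrev
  split_ifs <;> rfl

theorem cycleNext_cyclePrev {n : ℕ} (i : Fin n) : cycleNext (cyclePrev i) = i := by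
  ext
  have := i.isLt
  rw [cycleNext_val, cyclePrev_val]
  split_ifs <;> omega

theorem cyclePrev_cycleNext {n : ℕ} (i : Fin n) : cyclePrev (cycleNext i) = i := by
  have := i.isLt
  have h := cycleNext_val i
  generalize cycleNext i = j at h ⊢
  ext
  rw [cyclePrev_val]
  split_ifs at h ⊢ <;> omega

theorem isCycleEdge_or_iff {n : ℕ} (hn : 3 ≤ n) (i j : Fin n) :
    IsCycleEdge i j ∨ IsCycleEdge j i ↔ j = cycleNext i ∨ j = cyclePrev i := by
  have := i.isLt
  have := j.isLt
  simp only [IsCycleEdge, Fin.ext_iff, cycleNext_val, cyclePrev_val]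
  split_ifs <;> omega

/-- The prism edges in a normal form: the rungs directed from the first cycle to the second, and
the edges of the two cycles directed from the smaller to the larger index. -/
def IsPrismEdge {n : ℕ} (p q : Fin n × Fin 2) : Prop :=
  (p.1 = q.1 ∧ p.2 = 0 ∧ q.2 = 1) ∨ (p.2 = q.2 ∧ IsCycleEdge p.1 q.1)

theorem prismGraph_adj_iff {n : ℕ} (hn : 3 ≤ n) (p q : Fin n × Fin 2) :
    (prismGraph n).Adj p q ↔ IsPrismEdge p q ∨ IsPrismEdge q p := by
  unfold prismGraph IsPrismEdge
  rw [SimpleGraph.boxProd_adj, cycleGraph_adj_iff hn, SimpleGraph.pathGraph_adj]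
  simp only [Fin.ext_iff, Fin.val_zero, Fin.val_one]
  have := p.2.isLt
  have := q.2.isLt
  constructor
  · rintro (⟨h1 | h1, h2⟩ | ⟨h1 | h1, h2⟩)
    · exact Or.inl (Or.inr ⟨h2, h1⟩)
    · exact Or.inr (Or.inr ⟨h2.symm, h1⟩)
    · exact Or.inl (Or.inl (by omega))
    · exact Or.inr (Or.inl (by omega))
  · rintro ((h | h) | (h | h))
    · exact Or.inr (by omega)
    · exact Or.inl ⟨Or.inl h.2, h.1⟩
    · exact Or.inr (by omega)
    · exact Or.inl ⟨Or.inr h.2, h.1.symm⟩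

/-- The partner of a vertex of the prism in the perfect matching of a given colour, for a colouring
of the edges of the two cycles by three colours in which the rungs receive the missing colour. -/
def prismPartner {n : ℕ} (col : Fin n → Fin 3) (c : Fin 3) (p : Fin n × Fin 2) : Fin n × Fin 2 :=
  if col p.1 = c then (cycleNext p.1, p.2)
  else if col (cyclePrev p.1) = c then (cyclePrev p.1, p.2) else (p.1, 1 - p.2)

theorem prismPartner_involutive {n : ℕ} {col : Fin n → Fin 3}
    (hcol : ∀ i, col i ≠ col (cycleNext i)) (c : Fin 3) (p : Fin n × Fin 2) :
    prismPartner col c (prismPartner col c p) = p := by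
  obtain ⟨i, s⟩ := p
  have hprev := hcol (cyclePrev i)
  have hnext := hcol i
  rw [cycleNext_cyclePrev] at hprev
  by_cases h1 : col i = c
  · subst h1
    simp [prismPartner, hnext.symm, cyclePrev_cycleNext]
  · by_cases h2 : col (cyclePrev i) = c
    · subst h2
      simp [prismPartner, h1, cycleNext_cyclePrev]
    · simp [prismPartner, h1, h2]

theorem exists_cycle_coloring {n : ℕ} (hn : 3 ≤ n) :
    ∃ col : Fin n → Fin 3, ∀ i, col i ≠ col (cycleNext i) := by
  -- `col i` colours the edge from `i` to its successor: alternate 0 and 1, with 2 on the closing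
  -- edge so that odd cycles are covered too.
  refine ⟨fun i => if i.val + 1 = n then 2 else if i.val % 2 = 0 then 0 else 1, fun i => ?_⟩
  have := i.isLt
  simp only [cycleNext_val]
  split_ifs <;> first | decide | omega

/-- Both cycles carry the same colours, so the two ends of a rung miss the same third colour and the
rung can take it. -/
theorem prismGraph_adj_iff_exists_prismPartner {n : ℕ} (hn : 3 ≤ n) {col : Fin n → Fin 3}
    (hcol : ∀ i, col i ≠ col (cycleNext i)) (p q : Fin n × Fin 2) :
    (prismGraph n).Adj p q ↔ ∃ c, prismPartner col c p = q := by
  obtain ⟨i, s⟩ := p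
  obtain ⟨j, t⟩ := q
  have hprev := hcol (cyclePrev i)
  rw [cycleNext_cyclePrev] at hprev
  unfold prismGraph
  rw [SimpleGraph.boxProd_adj, cycleGraph_adj_iff hn, isCycleEdge_or_iff hn,
    SimpleGraph.pathGraph_adj]
  have hst : s.val + 1 = t.val ∨ t.val + 1 = s.val ↔ t = 1 - s := by
    revert s t
    decide
  rw [hst]
  simp only
  constructor
  · rintro (⟨rfl | rfl, rfl⟩ | ⟨rfl, rfl⟩)
    · exact ⟨col i, by simp [prismPartner]⟩
    · exact ⟨col (cyclePrev i), by simp [prismPartner, hprev.symm]⟩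
    · obtain ⟨c, h1, h2⟩ : ∃ c, col i ≠ c ∧ col (cyclePrev i) ≠ c := by
        generalize col i = a
        generalize col (cyclePrev i) = b
        revert a b
        decide
      exact ⟨c, by simp [prismPartner, h1, h2]⟩
  · rintro ⟨c, hc⟩
    unfold prismPartner at hc
    split_ifs at hc <;> simp only [Prod.mk.injEq] at hc <;> obtain ⟨rfl, rfl⟩ := hc
    · exact Or.inl ⟨Or.inl rfl, rfl⟩
    · exact Or.inl ⟨Or.inr rfl, rfl⟩
    · exact Or.inr ⟨rfl, rfl⟩

theorem cycleNext_ne_cyclePrev {n : ℕ} (hn : 3 ≤ n) (i : Fin n) : cycleNext i ≠ cyclePrev i := by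
  intro h
  have := i.isLt
  rw [Fin.ext_iff, cycleNext_val, cyclePrev_val] at h
  split_ifs at h <;> omega

theorem prismPartner_injective {n : ℕ} (hn : 3 ≤ n) {col : Fin n → Fin 3}
    (hcol : ∀ i, col i ≠ col (cycleNext i)) {c d : Fin 3} {p : Fin n × Fin 2}
    (h : prismPartner col c p = prismPartner col d p) : c = d := by
  obtain ⟨i, s⟩ := p
  have hprev := hcol (cyclePrev i)
  rw [cycleNext_cyclePrev] at hprev
  have hs : ∀ s : Fin 2, s ≠ 1 - s := by decide
  have hnp := cycleNext_ne_cyclePrev hn i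
  have hthird : ∀ a b c d : Fin 3, b ≠ a → a ≠ c → b ≠ c → a ≠ d → b ≠ d → c = d := by decide
  have hval : ∀ c, (col i = c ∧ prismPartner col c (i, s) = (cycleNext i, s)) ∨
      (col (cyclePrev i) = c ∧ prismPartner col c (i, s) = (cyclePrev i, s)) ∨
      (col i ≠ c ∧ col (cyclePrev i) ≠ c ∧ prismPartner col c (i, s) = (i, 1 - s)) := by
    intro c
    unfold prismPartner
    split_ifs with h1 h2
    · exact Or.inl ⟨h1, rfl⟩
    · exact Or.inr (Or.inl ⟨h2, rfl⟩)
    · exact Or.inr (Or.inr ⟨h1, h2, rfl⟩)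
  rcases hval c with ⟨h1, e1⟩ | ⟨h1, e1⟩ | ⟨h1, h1', e1⟩ <;>
    rcases hval d with ⟨h2, e2⟩ | ⟨h2, e2⟩ | ⟨h2, h2', e2⟩ <;> rw [e1, e2] at h
  · exact h1.symm.trans h2
  · exact absurd (congrArg Prod.fst h) hnp
  · exact absurd (congrArg Prod.snd h) (hs s)
  · exact absurd (congrArg Prod.fst h).symm hnp
  · exact h1.symm.trans h2
  · exact absurd (congrArg Prod.snd h) (hs s)
  · exact absurd (congrArg Prod.snd h).symm (hs s)
  · exact absurd (congrArg Prod.snd h).symm (hs s)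
  · exact hthird _ _ c d hprev h1 h1' h2 h2'

/-- Rungs lie in no triangle, and a cycle of length at least four contains none; for `n = 3` this
fails. -/
theorem prismGraph_cliqueFree {n : ℕ} (hn : 4 ≤ n) : (prismGraph n).CliqueFree 3 := by
  intro s hs
  obtain ⟨a, b, c, hab, hac, hbc, -⟩ := SimpleGraph.is3Clique_iff.1 hs
  rw [prismGraph_adj_iff (by omega)] at hab hac hbc
  simp only [IsPrismEdge, IsCycleEdge, Fin.ext_iff, Fin.val_zero, Fin.val_one] at hab hac hbc
  omega

/-- The position of a vertex of the prism: the two cycles lie on two parabolas that face each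
other. -/
noncomputable def prismPoint {n : ℕ} (p : Fin n × Fin 2) : Plane :=
  !₂[(p.1.val : ℝ), (if p.2 = 0 then 1 else -1) * ((n : ℝ) ^ 2 + (p.1.val : ℝ) ^ 2)]

theorem prismPoint_injective (n : ℕ) : Function.Injective (prismPoint (n := n)) := by
  rintro ⟨i, s⟩ ⟨j, t⟩ h
  have h0 := congrArg (fun p : Plane => p 0) h
  have h1 := congrArg (fun p : Plane => p 1) h
  simp only [prismPoint, PiLp.toLp_apply, Matrix.cons_val_zero, Matrix.cons_val_one,
    Matrix.cons_val_fin_one] at h0 h1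
  have hij : i = j := Fin.ext (by exact_mod_cast h0)
  subst hij
  have hn : (0 : ℝ) < n := by exact_mod_cast i.pos
  have : s = t := by
    fin_cases s <;> fin_cases t <;> simp at h1 ⊢ <;> nlinarith [sq_nonneg (i.val : ℝ)]
  rw [this]

theorem orient_rotate (p q r : Plane) : orient p q r = orient q r p := by
  unfold orient
  ring

theorem orient_prismPoint_same {n : ℕ} {i j k : Fin n} (s : Fin 2) (hij : i ≠ j) (hik : i ≠ k)
    (hjk : j ≠ k) : orient (prismPoint (i, s)) (prismPoint (j, s)) (prismPoint (k, s)) ≠ 0 := by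
  have hsub : ∀ i j : Fin n, i ≠ j → ((j.val : ℝ) - i.val) ≠ 0 := by
    intro i j hij h
    exact hij (Fin.ext (by exact_mod_cast (sub_eq_zero.1 h).symm))
  have : orient (prismPoint (i, s)) (prismPoint (j, s)) (prismPoint (k, s)) =
      (if s = 0 then 1 else -1) *
        (((j.val : ℝ) - i.val) * (k.val - i.val) * (k.val - j.val)) := by
    simp only [orient, prismPoint, PiLp.toLp_apply, Matrix.cons_val_zero, Matrix.cons_val_one,
      Matrix.cons_val_fin_one]
    ring
  rw [this]
  refine mul_ne_zero (by split_ifs <;> norm_num)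
    (mul_ne_zero (mul_ne_zero (hsub i j hij) (hsub i k hik)) (hsub j k hjk))

/-- The orientation factors through `j - i` and a quantity that is positive because `i * j < n ^ 2`.
The offset `n ^ 2` of the parabolas thus secures general position. -/
theorem orient_prismPoint_ne {n : ℕ} {i j : Fin n} (k : Fin n) {s t : Fin 2} (hij : i ≠ j)
    (hst : s ≠ t) : orient (prismPoint (i, s)) (prismPoint (j, s)) (prismPoint (k, t)) ≠ 0 := by
  have hsub : ((j.val : ℝ) - i.val) ≠ 0 := by
    intro h
    exact hij (Fin.ext (by exact_mod_cast (sub_eq_zero.1 h).symm))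
  have hi : (i.val : ℝ) < n := by exact_mod_cast i.isLt
  have hj : (j.val : ℝ) < n := by exact_mod_cast j.isLt
  have hi0 : (0 : ℝ) ≤ i.val := by positivity
  have hj0 : (0 : ℝ) ≤ j.val := by positivity
  have hk0 : (0 : ℝ) ≤ k.val := by positivity
  have hpos : 0 < 2 * (n : ℝ) ^ 2 + (k.val : ℝ) ^ 2 - i.val * j.val +
      (i.val + j.val) * k.val := by
    nlinarith [mul_nonneg hi0 hk0, mul_nonneg hj0 hk0, sq_nonneg (k.val : ℝ),
      mul_nonneg hi0 (sub_pos.2 hj).le, mul_nonneg (hi0.trans hi.le) (sub_pos.2 hi).le,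
      pow_pos (hi0.trans_lt hi) 2]
  have ht : (if t = 0 then (1 : ℝ) else -1) = -(if s = 0 then 1 else -1) := by
    revert hst
    fin_cases s <;> fin_cases t <;> simp
  have : orient (prismPoint (i, s)) (prismPoint (j, s)) (prismPoint (k, t)) =
      -(if s = 0 then 1 else -1) * (((j.val : ℝ) - i.val) *
        (2 * (n : ℝ) ^ 2 + (k.val : ℝ) ^ 2 - i.val * j.val + (i.val + j.val) * k.val)) := by
    simp only [orient, prismPoint, PiLp.toLp_apply, Matrix.cons_val_zero, Matrix.cons_val_one,
      Matrix.cons_val_fin_one, ht]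
    ring
  rw [this]
  exact mul_ne_zero (by split_ifs <;> norm_num) (mul_ne_zero hsub hpos.ne')

theorem orient_prismPoint {n : ℕ} {a b c : Fin n × Fin 2} (hab : a ≠ b) (hac : a ≠ c)
    (hbc : b ≠ c) : orient (prismPoint a) (prismPoint b) (prismPoint c) ≠ 0 := by
  obtain ⟨i, s⟩ := a
  obtain ⟨j, t⟩ := b
  obtain ⟨k, u⟩ := c
  by_cases hst : s = t
  · subst hst
    have hij : i ≠ j := fun h => hab (by rw [h])
    by_cases hsu : s = u
    · subst hsu
      exact orient_prismPoint_same s hij (fun h => hac (by rw [h])) fun h => hbc (by rw [h])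
    · exact orient_prismPoint_ne k hij hsu
  · by_cases htu : t = u
    · subst htu
      rw [orient_rotate]
      exact orient_prismPoint_ne i (fun h => hbc (by rw [h])) (Ne.symm hst)
    · have hsu : s = u := by omega
      subst hsu
      rw [orient_rotate, orient_rotate]
      exact orient_prismPoint_ne j (fun h => hac (by rw [h])) hst

/-- The points of a drawn rung, and of a drawn edge of one of the two cycles. -/
theorem mem_openSegment_prismPoint {n : ℕ} {p q : Fin n × Fin 2} (h : IsPrismEdge p q) {z : Plane}
    (hz : z ∈ openSegment ℝ (prismPoint p) (prismPoint q)) :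
    (p.1 = q.1 ∧ p.2 = 0 ∧ q.2 = 1 ∧ z 0 = p.1.val ∧ |z 1| < (n : ℝ) ^ 2 + z 0 ^ 2) ∨
    (p.2 = q.2 ∧ IsCycleEdge p.1 q.1 ∧ (p.1.val : ℝ) < z 0 ∧ z 0 < q.1.val ∧
      (if p.2 = 0 then 1 else -1) * z 1 = (n : ℝ) ^ 2 + z 0 ^ 2 +
        (z 0 - p.1.val) * (q.1.val - z 0)) := by
  obtain ⟨i, s⟩ := p
  obtain ⟨j, t⟩ := q
  obtain ⟨α, β, hα, hβ, hαβ, h0, h1⟩ := mem_openSegment_coord hz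
  simp only [prismPoint, PiLp.toLp_apply, Matrix.cons_val_zero, Matrix.cons_val_one,
    Matrix.cons_val_fin_one] at h0 h1
  obtain rfl : α = 1 - β := by linarith
  unfold IsPrismEdge at h
  simp only at h ⊢
  rcases h with ⟨rfl, rfl, rfl⟩ | ⟨rfl, hc⟩
  · left
    have hz0 : z 0 = i.val := by
      rw [h0]
      ring
    have hn : (0 : ℝ) < n := by exact_mod_cast i.pos
    have hpos : 0 < (n : ℝ) ^ 2 + (i.val : ℝ) ^ 2 := by positivity
    refine ⟨rfl, rfl, rfl, hz0, ?_⟩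
    rw [hz0, abs_lt, h1]
    simp
    constructor <;> nlinarith
  · right
    have hlt : (i.val : ℝ) < j.val := by
      have : i.val < j.val := by
        unfold IsCycleEdge at hc
        omega
      exact_mod_cast this
    refine ⟨rfl, hc, ?_, ?_, ?_⟩
    · rw [h0]
      nlinarith
    · rw [h0]
      nlinarith
    · rw [h0, h1]
      split_ifs <;> ring

/-- Rungs lie strictly between the two parabolas and cycle edges strictly beyond them, so only two
rungs or two edges of one cycle need comparing. -/
theorem disjoint_openSegment_prismPoint {n : ℕ} {p q p' q' : Fin n × Fin 2} (h : IsPrismEdge p q)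
    (h' : IsPrismEdge p' q') (hne : ¬ (p = p' ∧ q = q')) :
    Disjoint (openSegment ℝ (prismPoint p) (prismPoint q))
      (openSegment ℝ (prismPoint p') (prismPoint q')) := by
  rw [Set.disjoint_left]
  intro z hz hz'
  have hsign : ∀ s : Fin 2, (if s = 0 then (1 : ℝ) else -1) * z 1 ≤ |z 1| := by
    intro s
    split_ifs
    · simpa using le_abs_self (z 1)
    · simpa using neg_le_abs (z 1)
  rcases mem_openSegment_prismPoint h hz with ⟨e1, e2, e3, e4, e5⟩ | ⟨e1, e2, e3, e4, e5⟩ <;>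
    rcases mem_openSegment_prismPoint h' hz' with ⟨g1, g2, g3, g4, g5⟩ | ⟨g1, g2, g3, g4, g5⟩
  · have : p.1 = p'.1 := Fin.ext (Nat.cast_injective (R := ℝ) (e4.symm.trans g4))
    refine hne ⟨Prod.ext this (e2.trans g2.symm), Prod.ext ?_ (e3.trans g3.symm)⟩
    rw [← e1, ← g1, this]
  · nlinarith [hsign p'.2, mul_pos (sub_pos.2 g3) (sub_pos.2 g4)]
  · nlinarith [hsign p.2, mul_pos (sub_pos.2 e3) (sub_pos.2 e4)]
  · have m1 := mul_pos (sub_pos.2 e3) (sub_pos.2 e4)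
    have m2 := mul_pos (sub_pos.2 g3) (sub_pos.2 g4)
    by_cases hs : p.2 = p'.2
    · have heq : (z 0 - p.1.val) * (q.1.val - z 0) = (z 0 - p'.1.val) * (q'.1.val - z 0) := by
        rw [hs] at e5
        linarith
      have hne' : ¬ (p.1.val = p'.1.val ∧ q.1.val = q'.1.val) := by
        rintro ⟨f1, f2⟩
        exact hne ⟨Prod.ext (Fin.ext f1) hs, Prod.ext (Fin.ext f2) (by rw [← e1, ← g1, hs])⟩
      unfold IsCycleEdge at e2 g2
      -- Cycle edges join consecutive indices or close the cycle, so two of their intervals do not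
      -- overlap or are nested. In the nested case the excess over the parabola, the product of
      -- distances to the ends, is strictly larger for the longer interval.
      have hcase : q.1.val ≤ p'.1.val ∨ q'.1.val ≤ p.1.val ∨
          (p.1.val ≤ p'.1.val ∧ q'.1.val < q.1.val) ∨ (p.1.val < p'.1.val ∧ q'.1.val ≤ q.1.val) ∨
          (p'.1.val ≤ p.1.val ∧ q.1.val < q'.1.val) ∨
          (p'.1.val < p.1.val ∧ q.1.val ≤ q'.1.val) := by omega
      rcases hcase with f | f | ⟨f1, f2⟩ | ⟨f1, f2⟩ | ⟨f1, f2⟩ | ⟨f1, f2⟩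
      · have : (q.1.val : ℝ) ≤ p'.1.val := by exact_mod_cast f
        linarith
      · have : (q'.1.val : ℝ) ≤ p.1.val := by exact_mod_cast f
        linarith
      all_goals
        rify at f1 f2
        nlinarith
    · have h2 : (if p'.2 = 0 then (1 : ℝ) else -1) = -(if p.2 = 0 then 1 else -1) := by
        generalize p.2 = s at *
        generalize p'.2 = t at *
        revert hs
        fin_cases s <;> fin_cases t <;> simp
      rw [h2] at g5
      nlinarith [sq_nonneg (n : ℝ), sq_nonneg (z 0)]

theorem exists_isGreatest_packingSizes_three (n : ℕ) (hn : 4 ≤ n) :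
    ∃ S : Finset Plane, S.card = 2 * n ∧ InGeneralPosition S ∧
      IsGreatest (packingSizes S) 3 ∧
      ∃ F : Fin 3 → (completeGeometricGraph S).Subgraph, IsPlaneTriangleFreePacking S 3 F ∧
        Nonempty (unionGraph F ≃g prismGraph n) := by
  obtain ⟨S, hcard, e, he⟩ := exists_finset_equiv (prismPoint_injective n)
  rw [Fintype.card_prod, Fintype.card_fin, Fintype.card_fin, mul_comm] at hcard
  have hgp : InGeneralPosition S := inGeneralPosition_of_equiv e fun a b c hab hac hbc => by
    rw [he, he, he]
    exact orient_prismPoint hab hac hbc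
  obtain ⟨col, hcol⟩ := exists_cycle_coloring (n := n) (by omega)
  have hadj := prismGraph_adj_iff_exists_prismPartner (by omega) hcol
  obtain ⟨F, hF⟩ := exists_packing_of_involutions e (prismPartner col)
    (prismPartner_involutive hcol)
    (fun c v h => ((hadj v v).2 ⟨c, h⟩).ne rfl)
    (fun c d v h => prismPartner_injective (by omega) hcol h) (prismGraph n) hadj
    (prismGraph_cliqueFree hn)
    (by
      intro a b c d hab hcd hne
      rw [prismGraph_adj_iff (by omega)] at hab hcd
      rw [he, he, he, he]
      have hne1 : ¬ (a = c ∧ b = d) := fun h => hne (by rw [h.1, h.2])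
      have hne2 : ¬ (a = d ∧ b = c) := fun h => hne (by rw [h.1, h.2, Sym2.eq_swap])
      rcases hab with hab | hab <;> rcases hcd with hcd | hcd
      · exact disjoint_openSegment_prismPoint hab hcd hne1
      · rw [openSegment_symm ℝ (prismPoint c)]
        exact disjoint_openSegment_prismPoint hab hcd hne2
      · rw [openSegment_symm ℝ (prismPoint a)]
        exact disjoint_openSegment_prismPoint hab hcd fun h => hne2 h.symm
      · rw [openSegment_symm ℝ (prismPoint a), openSegment_symm ℝ (prismPoint c)]
        exact disjoint_openSegment_prismPoint hab hcd fun h => hne1 h.symm)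
  refine ⟨S, hcard, hgp, ⟨⟨F, hF.1⟩, fun k hk => ?_⟩, F, hF⟩
  exact le_three_of_mem_packingSizes hgp (Finset.card_pos.1 (by omega)) hk

theorem mainTheorem7 (n : ℕ) (hn : 4 ≤ n) :
    (∀ S : Finset Plane, S.card = 2 * n → InGeneralPosition S →
      2 ∈ packingSizes S ∧ ∀ k ∈ packingSizes S, k ≤ 3) ∧
    (∃ S : Finset Plane, S.card = 2 * n ∧ InGeneralPosition S ∧
      IsGreatest (packingSizes S) 2) ∧
    (∃ S : Finset Plane, S.card = 2 * n ∧ InGeneralPosition S ∧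
      IsGreatest (packingSizes S) 3 ∧
      ∃ F : Fin 3 → (completeGeometricGraph S).Subgraph, IsPlaneTriangleFreePacking S 3 F ∧
        Nonempty (unionGraph F ≃g prismGraph n)) :=
  ⟨fun _ hcard hS => ⟨two_mem_packingSizes hS (by omega) hcard,
    fun _ hk => le_three_of_mem_packingSizes hS (Finset.card_pos.1 (by omega)) hk⟩,
    exists_isGreatest_packingSizes_two n (by omega), exists_isGreatest_packingSizes_three n hn⟩
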